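/- For a permutation $\pi$ of $\{1,\dots,n\}$ let $inv(\pi)=\#\{(i,j): 1\le i<j\le n,\ \pi_i>\pi_j\}$ be its number of inversions and let $na(\pi)=\sum_{i=1}^n|\pi_i-i|$ be Spearman's footrule. Let $\pi$ be uniformly distributed on the symmetric group $S_n$, let $\mu_{inv}=E[inv]$ and $\mu_{na}=E[na]$, and let $$m_{r,s}(n)=E\big[(inv-\mu_{inv})^r\,(na-\mu_{na})^s\big].$$ (1) For all integers $r,s\ge 0$ with $r+s\le 8$ and all $n\ge 0$ such that $s=0$ or $n\ge r+s$, one has $m_{r,s}(n)=P_{r,s}(n)$, where $P_{1,0}=P_{3,0}=P_{5,0}=P_{7,0}=0$ and the other polynomials are as follows. $$P_{0,0}(n)=1$$ $$P_{0,1}(n)=0$$ $$P_{2,0}(n)=\frac{1}{72}n(n-1)(2n+5)$$ $$P_{1,1}(n)=\frac{1}{30}(n+1)(n^{2}+1)$$ $$P_{0,2}(n)=\frac{1}{45}(n+1)(2n^{2}+7)$$ $$P_{2,1}(n)=-\frac{1}{630}(n+1)(n+2)(n^{2}+5)$$ $$P_{1,2}(n)=-\frac{1}{630}(n+1)(n+2)(2n^{2}+17)$$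 $$P_{0,3}(n)=-\frac{2}{945}(n+1)(n+2)(2n^{2}+31)$$ $$P_{4,0}(n)=\frac{1}{43200}n(n-1)(100n^{4}+328n^{3}-127n^{2}-997n-372)$$ $$P_{3,1}(n)=\frac{1}{5040}(n+1)(14n^{5}+9n^{4}-33n^{3}+21n^{2}+n+84)$$ $$P_{2,2}(n)=\frac{1}{113400}(n+1)(392n^{5}+90n^{4}+380n^{3}+1155n^{2}+1703n+6000)$$ $$P_{1,3}(n)=\frac{1}{3150}(n+1)(14n^{5}+55n^{3}+55n^{2}+231n+395)$$ $$P_{0,4}(n)=\frac{1}{4725}(n+1)(28n^{5}+180n^{3}+160n^{2}+887n+1265)$$ $$P_{4,1}(n)=-\frac{1}{83160}(n+1)(n+2)(22n^{5}+9n^{4}+19n^{3}+81n^{2}-167n+1260)$$ $$P_{3,2}(n)=-\frac{1}{831600}(n+1)(n+2)(484n^{5}+30n^{4}+2256n^{3}+1557n^{2}+833n+37860)$$ $$P_{2,3}(n)=-\frac{1}{1871100}(n+1)(n+2)(1804n^{5}-270n^{4}+15424n^{3}+4203n^{2}+33379n+189900)$$ $$P_{1,4}(n)=-\frac{1}{155925}(n+1)(n+2)(220n^{5}-50n^{4}+2796n^{3}+342n^{2}+9707n+31115)$$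 $$P_{0,5}(n)=-\frac{4}{93555}(n+1)(n+2)(44n^{5}-10n^{4}+788n^{3}+86n^{2}+3587n+8555)$$ $$P_{6,0}(n)=\frac{1}{30481920}n(n-1)(9800n^{7}+32732n^{6}-42010n^{5}-230695n^{4}-72460n^{3}+400733n^{2}+391500n+118080)$$ $$P_{5,1}(n)=\frac{1}{259459200}(n+1)(100100n^{8}+56628n^{7}-556835n^{6}-18882n^{5}+1196050n^{4}+766422n^{3}+2005865n^{2}+12552732n+21890880)$$ $$P_{4,2}(n)=\frac{1}{13621608000}(n+1)(6446440n^{8}-82368n^{7}-11985750n^{6}+33565392n^{5}+66314535n^{4}+146271258n^{3}+336035945n^{2}+2204607348n+3324827520)$$ $$P_{3,3}(n)=\frac{1}{378378000}(n+1)(224224n^{8}-96954n^{7}+406084n^{6}+1779911n^{5}+4930576n^{4}+11406164n^{3}+25523106n^{2}+150493949n+198087540)$$ $$P_{2,4}(n)=\frac{1}{1702701000}(n+1)(1289288n^{8}-920348n^{7}+6729828n^{6}+12232052n^{5}+57839362n^{4}+112856303n^{3}+299424692n^{2}+1446621703n+1681765120)$$ $$P_{1,5}(n)=\frac{1}{85135050}(n+1)(84084n^{8}-72644n^{7}+689864n^{6}+920276n^{5}+6355741n^{4}+11282264n^{3}+35157976n^{2}+141053344n+147352415)$$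 $$P_{0,6}(n)=\frac{1}{127702575}(n+1)(168168n^{8}-145288n^{7}+1800148n^{6}+2180892n^{5}+18508182n^{4}+32547228n^{3}+112117257n^{2}+385870348n+368963105)$$ $$P_{6,1}(n)=-\frac{1}{259459200}(n+1)(n+2)(14300n^{8}+1404n^{7}-48285n^{6}+53850n^{5}+52050n^{4}+1384266n^{3}+289195n^{2}+9735780n+43243200)$$ $$P_{5,2}(n)=-\frac{1}{5448643200}(n+1)(n+2)(680680n^{8}-304824n^{7}+504350n^{6}+3359376n^{5}+3792995n^{4}+91799274n^{3}-8779175n^{2}+750949884n+2565218880)$$ $$P_{4,3}(n)=-\frac{1}{20432412000}(n+1)(n+2)(4380376n^{8}-3814200n^{7}+21293790n^{6}+14423784n^{5}+92764569n^{4}+766906350n^{3}-103586305n^{2}+7305979236n+20179983600)$$ $$P_{3,4}(n)=-\frac{1}{1702701000}(n+1)(n+2)(560560n^{8}-659360n^{7}+4995326n^{6}-5122n^{5}+27772760n^{4}+120508115n^{3}+5964334n^{2}+1340518327n+3106600140)$$ $$P_{2,5}(n)=-\frac{1}{766215450}(n+1)(n+2)(364364n^{8}-498784n^{7}+4699842n^{6}-1452330n^{5}+32645271n^{4}+93362619n^{3}+40893298n^{2}+1198767295n+2399560905)$$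 $$P_{1,6}(n)=-\frac{1}{85135050}(n+1)(n+2)(56056n^{8}-81536n^{7}+949900n^{6}-442704n^{5}+7901574n^{4}+17110296n^{3}+16999265n^{2}+246077144n+435604925)$$ $$P_{0,7}(n)=-\frac{2}{18243225}(n+1)(n+2)(8008n^{8}-11648n^{7}+171164n^{6}-88560n^{5}+1645002n^{4}+2988888n^{3}+4890161n^{2}+46078520n+73541545)$$ $$P_{8,0}(n)=\frac{1}{7838208000}n(n-1)(490000n^{10}+1313200n^{9}-4396152n^{8}-15952512n^{7}+4246473n^{6}+62414373n^{5}+59298827n^{4}-49258153n^{3}-138803688n^{2}-113130288n-33747840)$$ $$P_{7,1}(n)=\frac{1}{317578060800}(n+1)(23823800n^{11}-5513508n^{10}-196361458n^{9}+64947141n^{8}+630135423n^{7}+154268856n^{6}+810716830n^{5}+8698646439n^{4}+14839475797n^{3}+102324546072n^{2}+479281447728n+563078355840)$$ $$P_{6,2}(n)=\frac{1}{16672848192000}(n+1)(1524723200n^{11}-1427736024n^{10}-5499946760n^{9}+14976232470n^{8}+19199714520n^{7}+10707280353n^{6}+219143520625n^{5}+1412316116505n^{4}+2311709580755n^{3}+17273556441396n^{2}+74363178994560n+82141701350400)$$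 $$P_{5,3}(n)=\frac{1}{463134672000}(n+1)(52412360n^{11}-77247456n^{10}+60683370n^{9}+647999140n^{8}+840667845n^{7}+1937718237n^{6}+15567082960n^{5}+88350334860n^{4}+143286866145n^{3}+1144499966519n^{2}+4522596215220n+4717117310400)$$ $$P_{4,4}(n)=\frac{1}{3473510040000}(n+1)(493629136n^{11}-925530320n^{10}+2847632940n^{9}+6071639640n^{8}+18325935628n^{7}+39174467640n^{6}+270446041895n^{5}+1331971412135n^{4}+2202855668961n^{3}+17979024108405n^{2}+65216298539540n+64518734534400)$$ $$P_{3,5}(n)=\frac{1}{173675502000}(n+1)(31447416n^{11}-68038828n^{10}+315354760n^{9}+351734900n^{8}+2311253638n^{7}+4033754991n^{6}+29477729295n^{5}+124959924100n^{4}+219693234446n^{3}+1741491398137n^{2}+5808096918245n+5475164345700)$$ $$P_{2,6}(n)=\frac{1}{781539759000}(n+1)(182966784n^{11}-430948232n^{10}+2523566360n^{9}+1860954620n^{8}+22225470952n^{7}+33916009974n^{6}+271343881500n^{5}+1007982080555n^{4}+1942265002789n^{3}+14354704237483n^{2}+44171701450415n+39861925527600)$$ $$P_{1,7}(n)=\frac{1}{9304044750}(n+1)(2858856n^{11}-7020728n^{10}+48471420n^{9}+28629960n^{8}+505937118n^{7}+733716956n^{6}+6223574055n^{5}+20871320465n^{4}+44569102776n^{3}+299454162972n^{2}+854228014575n+741352644775)$$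 $$P_{0,8}(n)=\frac{1}{13956067125}(n+1)(5717712n^{11}-14041456n^{10}+111237120n^{9}+63288800n^{8}+1347724536n^{7}+1996817312n^{6}+17098013040n^{5}+53375545600n^{4}+125630091477n^{3}+758605059019n^{2}+2016696623115n+1690532291725)$$ (2) The correlation of $inv$ and $na$ tends to $\rho=\frac{3}{\sqrt{10}}$: $\displaystyle\lim_{n\to\infty}\frac{m_{1,1}(n)}{\sqrt{m_{2,0}(n)}\,\sqrt{m_{0,2}(n)}}=\frac{3}{\sqrt{10}}$. (3) For all $r,s\ge0$ with $r+s\le 8$, the scaled mixed moments of $(inv,na)$ tend to those of the bivariate normal distribution with correlation $\rho=\frac{3}{\sqrt{10}}$. That is, for all $\sigma_1,\sigma_2>0$, $$\lim_{n\to\infty}\frac{m_{r,s}(n)}{m_{2,0}(n)^{r/2}\,m_{0,2}(n)^{s/2}}=\frac{1}{\sigma_1^{r}\sigma_2^{s}}\int_{\mathbb R^2}x^r y^s f_{\sigma_1,\sigma_2,\rho}(x,y)\,dx\,dy,$$ where the integral converges absolutely and $$f_{\sigma_1,\sigma_2,\rho}(x,y)=\frac{1}{2\pi\sigma_1\sigma_2\sqrt{1-\rho^2}}\exp\!\Big(-\frac{1}{2(1-\rho^2)}\Big(\frac{x^2}{\sigma_1^2}-\frac{2\rho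 xy}{\sigma_1\sigma_2}+\frac{y^2}{\sigma_2^2}\Big)\Big)$$ is the density of the centered bivariate normal distribution with standard deviations $\sigma_1,\sigma_2$ and correlation $\rho$. (For $\sigma_1=\sigma_2=\sqrt{10}$ it is $\frac{1}{2\sqrt{10}\,\pi}e^{-x^2/2-y^2/2+\frac{3}{\sqrt{10}}xy}$.) -/

import Mathlib

open MeasureTheory Filter Topology

/-- The number of inversions of a permutation: the number of pairs `i < j` with `π j < π i`. -/
def permInv {n : ℕ} (π : Equiv.Perm (Fin n)) : ℕ :=
  (Finset.univ.filter fun p : Fin n × Fin n => p.1 < p.2 ∧ π p.2 < π p.1).card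

/-- Spearman's footrule (total displacement) `∑ i, |π i - i|`. -/
def permNa {n : ℕ} (π : Equiv.Perm (Fin n)) : ℕ :=
  ∑ i : Fin n, (((π i : ℕ) : ℤ) - ((i : ℕ) : ℤ)).natAbs

/-- Expectation of `f` under the uniform distribution on the permutations of `n` letters. -/
def permExp (n : ℕ) (f : Equiv.Perm (Fin n) → ℚ) : ℚ :=
  (∑ π : Equiv.Perm (Fin n), f π) / (Fintype.card (Equiv.Perm (Fin n)) : ℚ)

/-- The mixed central moment `E[(inv - E inv) ^ r * (na - E na) ^ s]` over permutations of
`n` letters. -/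
def mixedMoment (n r s : ℕ) : ℚ :=
  permExp n fun π =>
    ((permInv π : ℚ) - permExp n fun τ => (permInv τ : ℚ)) ^ r *
      ((permNa π : ℚ) - permExp n fun τ => (permNa τ : ℚ)) ^ s

/-- The scaled mixed moment: `mixedMoment n r s` divided by the `r`-th power of the standard
deviation of `inv` and the `s`-th power of the standard deviation of `na`. -/
noncomputable def scaledMixedMoment (n r s : ℕ) : ℝ :=
  (mixedMoment n r s : ℝ) /
    (√(mixedMoment n 2 0 : ℝ) ^ r * √(mixedMoment n 0 2 : ℝ) ^ s)

/-- Density of the centered bivariate normal distribution with standard deviations `σ₁`, `σ₂`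
and correlation `ρ`. -/
noncomputable def bivariateNormalPDF (σ₁ σ₂ ρ x y : ℝ) : ℝ :=
  1 / (2 * Real.pi * σ₁ * σ₂ * √(1 - ρ ^ 2)) *
    Real.exp (-(1 / (2 * (1 - ρ ^ 2))) *
      (x ^ 2 / σ₁ ^ 2 - 2 * ρ * x * y / (σ₁ * σ₂) + y ^ 2 / σ₂ ^ 2))

/-- Mixed central moments of total order `0`, as polynomials in `n`, by the exponent of `na`. -/
def momentFormula0 (s : ℕ) (_n : ℚ) : ℚ :=
  match s with
  | 0 => 1
  | _ => 0

/-- Mixed central moments of total order `1`, as polynomials in `n`, by the exponent of `na`. -/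
def momentFormula1 (s : ℕ) (_n : ℚ) : ℚ :=
  match s with
  | 0 => 0
  | 1 => 0
  | _ => 0

/-- Mixed central moments of total order `2`, as polynomials in `n`, by the exponent of `na`. -/
def momentFormula2 (s : ℕ) (n : ℚ) : ℚ :=
  match s with
  | 0 => n * (n - 1) * (2 * n + 5) / 72
  | 1 => (n + 1) * (n ^ 2 + 1) / 30
  | 2 => (n + 1) * (2 * n ^ 2 + 7) / 45
  | _ => 0

/-- Mixed central moments of total order `3`, as polynomials in `n`, by the exponent of `na`. -/
def momentFormula3 (s : ℕ) (n : ℚ) : ℚ :=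
  match s with
  | 0 => 0
  | 1 => -(n + 1) * (n + 2) * (n ^ 2 + 5) / 630
  | 2 => -(n + 1) * (n + 2) * (2 * n ^ 2 + 17) / 630
  | 3 => -2 * (n + 1) * (n + 2) * (2 * n ^ 2 + 31) / 945
  | _ => 0

/-- Mixed central moments of total order `4`, as polynomials in `n`, by the exponent of `na`. -/
def momentFormula4 (s : ℕ) (n : ℚ) : ℚ :=
  match s with
  | 0 => n * (n - 1) * (100 * n ^ 4 + 328 * n ^ 3 - 127 * n ^ 2 - 997 * n - 372) / 43200
  | 1 => (n + 1) * (14 * n ^ 5 + 9 * n ^ 4 - 33 * n ^ 3 + 21 * n ^ 2 + n + 84) / 5040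
  | 2 =>
      (n + 1) * (392 * n ^ 5 + 90 * n ^ 4 + 380 * n ^ 3 + 1155 * n ^ 2 + 1703 * n + 6000) /
        113400
  | 3 => (n + 1) * (14 * n ^ 5 + 55 * n ^ 3 + 55 * n ^ 2 + 231 * n + 395) / 3150
  | 4 => (n + 1) * (28 * n ^ 5 + 180 * n ^ 3 + 160 * n ^ 2 + 887 * n + 1265) / 4725
  | _ => 0

/-- Mixed central moments of total order `5`, as polynomials in `n`, by the exponent of `na`. -/
def momentFormula5 (s : ℕ) (n : ℚ) : ℚ :=
  match s with
  | 0 => 0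
  | 1 =>
      -(n + 1) * (n + 2) * (22 * n ^ 5 + 9 * n ^ 4 + 19 * n ^ 3 + 81 * n ^ 2 - 167 * n
        + 1260) / 83160
  | 2 =>
      -(n + 1) * (n + 2) * (484 * n ^ 5 + 30 * n ^ 4 + 2256 * n ^ 3 + 1557 * n ^ 2
        + 833 * n + 37860) / 831600
  | 3 =>
      -(n + 1) * (n + 2) * (1804 * n ^ 5 - 270 * n ^ 4 + 15424 * n ^ 3 + 4203 * n ^ 2
        + 33379 * n + 189900) / 1871100
  | 4 =>
      -(n + 1) * (n + 2) * (220 * n ^ 5 - 50 * n ^ 4 + 2796 * n ^ 3 + 342 * n ^ 2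
        + 9707 * n + 31115) / 155925
  | 5 =>
      -4 * (n + 1) * (n + 2) * (44 * n ^ 5 - 10 * n ^ 4 + 788 * n ^ 3 + 86 * n ^ 2
        + 3587 * n + 8555) / 93555
  | _ => 0

/-- Mixed central moments of total order `6`, as polynomials in `n`, by the exponent of `na`. -/
def momentFormula6 (s : ℕ) (n : ℚ) : ℚ :=
  match s with
  | 0 =>
      n * (n - 1) * (9800 * n ^ 7 + 32732 * n ^ 6 - 42010 * n ^ 5 - 230695 * n ^ 4
        - 72460 * n ^ 3 + 400733 * n ^ 2 + 391500 * n + 118080) / 30481920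
  | 1 =>
      (n + 1) * (100100 * n ^ 8 + 56628 * n ^ 7 - 556835 * n ^ 6 - 18882 * n ^ 5
        + 1196050 * n ^ 4 + 766422 * n ^ 3 + 2005865 * n ^ 2 + 12552732 * n + 21890880) /
        259459200
  | 2 =>
      (n + 1) * (6446440 * n ^ 8 - 82368 * n ^ 7 - 11985750 * n ^ 6 + 33565392 * n ^ 5
        + 66314535 * n ^ 4 + 146271258 * n ^ 3 + 336035945 * n ^ 2 + 2204607348 * n
        + 3324827520) / 13621608000
  | 3 =>
      (n + 1) * (224224 * n ^ 8 - 96954 * n ^ 7 + 406084 * n ^ 6 + 1779911 * n ^ 5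
        + 4930576 * n ^ 4 + 11406164 * n ^ 3 + 25523106 * n ^ 2 + 150493949 * n + 198087540)
        / 378378000
  | 4 =>
      (n + 1) * (1289288 * n ^ 8 - 920348 * n ^ 7 + 6729828 * n ^ 6 + 12232052 * n ^ 5
        + 57839362 * n ^ 4 + 112856303 * n ^ 3 + 299424692 * n ^ 2 + 1446621703 * n
        + 1681765120) / 1702701000
  | 5 =>
      (n + 1) * (84084 * n ^ 8 - 72644 * n ^ 7 + 689864 * n ^ 6 + 920276 * n ^ 5
        + 6355741 * n ^ 4 + 11282264 * n ^ 3 + 35157976 * n ^ 2 + 141053344 * n + 147352415)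
        / 85135050
  | 6 =>
      (n + 1) * (168168 * n ^ 8 - 145288 * n ^ 7 + 1800148 * n ^ 6 + 2180892 * n ^ 5
        + 18508182 * n ^ 4 + 32547228 * n ^ 3 + 112117257 * n ^ 2 + 385870348 * n
        + 368963105) / 127702575
  | _ => 0

/-- Mixed central moments of total order `7`, as polynomials in `n`, by the exponent of `na`. -/
def momentFormula7 (s : ℕ) (n : ℚ) : ℚ :=
  match s with
  | 0 => 0
  | 1 =>
      -(n + 1) * (n + 2) * (14300 * n ^ 8 + 1404 * n ^ 7 - 48285 * n ^ 6 + 53850 * n ^ 5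
        + 52050 * n ^ 4 + 1384266 * n ^ 3 + 289195 * n ^ 2 + 9735780 * n + 43243200) /
        259459200
  | 2 =>
      -(n + 1) * (n + 2) * (680680 * n ^ 8 - 304824 * n ^ 7 + 504350 * n ^ 6
        + 3359376 * n ^ 5 + 3792995 * n ^ 4 + 91799274 * n ^ 3 - 8779175 * n ^ 2
        + 750949884 * n + 2565218880) / 5448643200
  | 3 =>
      -(n + 1) * (n + 2) * (4380376 * n ^ 8 - 3814200 * n ^ 7 + 21293790 * n ^ 6
        + 14423784 * n ^ 5 + 92764569 * n ^ 4 + 766906350 * n ^ 3 - 103586305 * n ^ 2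
        + 7305979236 * n + 20179983600) / 20432412000
  | 4 =>
      -(n + 1) * (n + 2) * (560560 * n ^ 8 - 659360 * n ^ 7 + 4995326 * n ^ 6
        - 5122 * n ^ 5 + 27772760 * n ^ 4 + 120508115 * n ^ 3 + 5964334 * n ^ 2
        + 1340518327 * n + 3106600140) / 1702701000
  | 5 =>
      -(n + 1) * (n + 2) * (364364 * n ^ 8 - 498784 * n ^ 7 + 4699842 * n ^ 6
        - 1452330 * n ^ 5 + 32645271 * n ^ 4 + 93362619 * n ^ 3 + 40893298 * n ^ 2
        + 1198767295 * n + 2399560905) / 766215450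
  | 6 =>
      -(n + 1) * (n + 2) * (56056 * n ^ 8 - 81536 * n ^ 7 + 949900 * n ^ 6 - 442704 * n ^ 5
        + 7901574 * n ^ 4 + 17110296 * n ^ 3 + 16999265 * n ^ 2 + 246077144 * n + 435604925)
        / 85135050
  | 7 =>
      -2 * (n + 1) * (n + 2) * (8008 * n ^ 8 - 11648 * n ^ 7 + 171164 * n ^ 6
        - 88560 * n ^ 5 + 1645002 * n ^ 4 + 2988888 * n ^ 3 + 4890161 * n ^ 2 + 46078520 * n
        + 73541545) / 18243225
  | _ => 0

/-- Mixed central moments of total order `8`, as polynomials in `n`, by the exponent of `na`. -/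
def momentFormula8 (s : ℕ) (n : ℚ) : ℚ :=
  match s with
  | 0 =>
      n * (n - 1) * (490000 * n ^ 10 + 1313200 * n ^ 9 - 4396152 * n ^ 8 - 15952512 * n ^ 7
        + 4246473 * n ^ 6 + 62414373 * n ^ 5 + 59298827 * n ^ 4 - 49258153 * n ^ 3
        - 138803688 * n ^ 2 - 113130288 * n - 33747840) / 7838208000
  | 1 =>
      (n + 1) * (23823800 * n ^ 11 - 5513508 * n ^ 10 - 196361458 * n ^ 9
        + 64947141 * n ^ 8 + 630135423 * n ^ 7 + 154268856 * n ^ 6 + 810716830 * n ^ 5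
        + 8698646439 * n ^ 4 + 14839475797 * n ^ 3 + 102324546072 * n ^ 2 + 479281447728 * n
        + 563078355840) / 317578060800
  | 2 =>
      (n + 1) * (1524723200 * n ^ 11 - 1427736024 * n ^ 10 - 5499946760 * n ^ 9
        + 14976232470 * n ^ 8 + 19199714520 * n ^ 7 + 10707280353 * n ^ 6
        + 219143520625 * n ^ 5 + 1412316116505 * n ^ 4 + 2311709580755 * n ^ 3
        + 17273556441396 * n ^ 2 + 74363178994560 * n + 82141701350400) / 16672848192000
  | 3 =>
      (n + 1) * (52412360 * n ^ 11 - 77247456 * n ^ 10 + 60683370 * n ^ 9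
        + 647999140 * n ^ 8 + 840667845 * n ^ 7 + 1937718237 * n ^ 6 + 15567082960 * n ^ 5
        + 88350334860 * n ^ 4 + 143286866145 * n ^ 3 + 1144499966519 * n ^ 2
        + 4522596215220 * n + 4717117310400) / 463134672000
  | 4 =>
      (n + 1) * (493629136 * n ^ 11 - 925530320 * n ^ 10 + 2847632940 * n ^ 9
        + 6071639640 * n ^ 8 + 18325935628 * n ^ 7 + 39174467640 * n ^ 6
        + 270446041895 * n ^ 5 + 1331971412135 * n ^ 4 + 2202855668961 * n ^ 3
        + 17979024108405 * n ^ 2 + 65216298539540 * n + 64518734534400) / 3473510040000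
  | 5 =>
      (n + 1) * (31447416 * n ^ 11 - 68038828 * n ^ 10 + 315354760 * n ^ 9
        + 351734900 * n ^ 8 + 2311253638 * n ^ 7 + 4033754991 * n ^ 6 + 29477729295 * n ^ 5
        + 124959924100 * n ^ 4 + 219693234446 * n ^ 3 + 1741491398137 * n ^ 2
        + 5808096918245 * n + 5475164345700) / 173675502000
  | 6 =>
      (n + 1) * (182966784 * n ^ 11 - 430948232 * n ^ 10 + 2523566360 * n ^ 9
        + 1860954620 * n ^ 8 + 22225470952 * n ^ 7 + 33916009974 * n ^ 6
        + 271343881500 * n ^ 5 + 1007982080555 * n ^ 4 + 1942265002789 * n ^ 3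
        + 14354704237483 * n ^ 2 + 44171701450415 * n + 39861925527600) / 781539759000
  | 7 =>
      (n + 1) * (2858856 * n ^ 11 - 7020728 * n ^ 10 + 48471420 * n ^ 9 + 28629960 * n ^ 8
        + 505937118 * n ^ 7 + 733716956 * n ^ 6 + 6223574055 * n ^ 5 + 20871320465 * n ^ 4
        + 44569102776 * n ^ 3 + 299454162972 * n ^ 2 + 854228014575 * n + 741352644775) /
        9304044750
  | 8 =>
      (n + 1) * (5717712 * n ^ 11 - 14041456 * n ^ 10 + 111237120 * n ^ 9
        + 63288800 * n ^ 8 + 1347724536 * n ^ 7 + 1996817312 * n ^ 6 + 17098013040 * n ^ 5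
        + 53375545600 * n ^ 4 + 125630091477 * n ^ 3 + 758605059019 * n ^ 2
        + 2016696623115 * n + 1690532291725) / 13956067125
  | _ => 0

/-- The explicit polynomials in `n` giving the mixed central moments of `(inv, na)` of total
order at most `8`; `r` is the exponent of `inv` and `s` that of `na`. -/
def mixedMomentFormula (r s : ℕ) (n : ℚ) : ℚ :=
  match r + s with
  | 0 => momentFormula0 s n
  | 1 => momentFormula1 s n
  | 2 => momentFormula2 s n
  | 3 => momentFormula3 s n
  | 4 => momentFormula4 s n
  | 5 => momentFormula5 s n
  | 6 => momentFormula6 s n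
  | 7 => momentFormula7 s n
  | 8 => momentFormula8 s n
  | _ => 0

/-!
The joint distribution of inversions and the footrule is computed by reading a permutation of
`n` letters one index at a time. After index `h` has been processed, a row that is sent to a later
column, or a column hit by a later row, is *open*; there are as many open rows as open columns.
Deleting the closed entries shows that only the number of open rows matters, and the generating
function `∑ q ^ inv * t ^ na` obeys a three-term recurrence in that number (`openSum_succ`). At
`q = t = 1` this is the recurrence of the Laguerre polynomials, solved by
`openCount m h = m! * m (m - 1) ⋯ (m - h + 1)`.

With `q = 1 + x` and `t = 1 + y` the coefficients are sums of `choose inv i * choose na j`. The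
coefficient of `x ^ i * y ^ j` satisfies the recurrence of `openCount` with a source built from the
coefficients of lower order. Multiplication by the height `h` and the up and down steps act on
`openCount (n - k) h` with coefficients polynomial in `n`, and an inhomogeneous recurrence is solved
by indefinite summation, so every coefficient is a combination of `openCount (n - k) h` with
polynomial coefficients of controlled degree (`binomSum_mem`). Consequently each central moment of
total order at most `8`, times `n (n - 1) ⋯ (n - 23)`, is a polynomial in `n` of degree at most `40`
(`isPolySeq_centeredSum`). The explicit formulas, times the same product, have degree at most `40`
too, so it is enough to compare the two sides for `n ≤ 40`. The recurrence makes this a small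
computation with integer tables (`formulasHoldFrom_forty`), and `centeredSum_eq` follows.

The limits are read off from the leading coefficients of the formulas (`tendsto_scaledMixedMoment`):
they are the moments of `(U, (3 U + V) / √10)` for independent standard normal `U` and `V`. The
linear substitution that makes the two coordinates independent gives the same values for the
bivariate normal integral (`integral_bivariateNormalPDF`).
-/

/-! ### Recurrence for the joint generating function -/

/-- Spearman's footrule with every position and value below `c` raised to `c`. -/
def clampedNa (c : ℕ) {n : ℕ} (σ : Equiv.Perm (Fin n)) : ℕ :=
  ∑ i : Fin n, (((max (σ i : ℕ) c : ℕ) : ℤ) - ((max (i : ℕ) c : ℕ) : ℤ)).natAbs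

/-- The condition that the first `a` rows avoid the first `b` columns. -/
def AvoidsCorner (a b : ℕ) {n : ℕ} (σ : Equiv.Perm (Fin n)) : Prop :=
  ∀ i : Fin n, (i : ℕ) < a → b ≤ (σ i : ℕ)

instance (a b n : ℕ) (σ : Equiv.Perm (Fin n)) : Decidable (AvoidsCorner a b σ) :=
  inferInstanceAs (Decidable (∀ i : Fin n, (i : ℕ) < a → b ≤ (σ i : ℕ)))

/-- The permutation of `n + 1` letters obtained from `τ` by inserting a new row `i` and a new
column `j`, with `i` sent to `j`. -/
def insertPerm {n : ℕ} (i j : Fin (n + 1)) (τ : Equiv.Perm (Fin n)) :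
    Equiv.Perm (Fin (n + 1)) :=
  (finSuccEquiv' i).trans ((Equiv.optionCongr τ).trans (finSuccEquiv' j).symm)

@[simp] lemma insertPerm_apply_self {n : ℕ} (i j : Fin (n + 1)) (τ : Equiv.Perm (Fin n)) :
    insertPerm i j τ i = j := by
  simp [insertPerm]

@[simp] lemma insertPerm_apply_succAbove {n : ℕ} (i j : Fin (n + 1)) (τ : Equiv.Perm (Fin n))
    (k : Fin n) : insertPerm i j τ (i.succAbove k) = j.succAbove (τ k) := by
  simp [insertPerm]

lemma insertPerm_injective {n : ℕ} (i j : Fin (n + 1)) :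
    Function.Injective (insertPerm i j) := by
  intro τ τ' h
  ext k
  have := congrArg (fun σ => σ (i.succAbove k)) h
  simp only [insertPerm_apply_succAbove, Fin.succAbove_right_inj] at this
  rw [this]

lemma exists_insertPerm {n : ℕ} {i j : Fin (n + 1)} {σ : Equiv.Perm (Fin (n + 1))}
    (h : σ i = j) : ∃ τ, insertPerm i j τ = σ := by
  have hne : ∀ k : Fin n, σ (i.succAbove k) ≠ j := fun k hk => by
    have := σ.injective (hk.trans h.symm)
    exact Fin.succAbove_ne i k this
  choose f hf using fun k => Fin.exists_succAbove_eq (hne k)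
  have hinj : Function.Injective f := fun k k' hkk => by
    have : σ (i.succAbove k) = σ (i.succAbove k') := by rw [← hf, ← hf, hkk]
    exact Fin.succAbove_right_injective (σ.injective this)
  refine ⟨Equiv.ofBijective f (Finite.injective_iff_bijective.1 hinj), ?_⟩
  ext r
  rcases Fin.eq_self_or_eq_succAbove i r with rfl | ⟨k, rfl⟩
  · simp [h]
  · simp [hf]

lemma sum_perm_eq_sum_insertPerm {n : ℕ} {M : Type*} [AddCommMonoid M] (i j : Fin (n + 1))
    (f : Equiv.Perm (Fin (n + 1)) → M) :
    ∑ σ, (if σ i = j then f σ else 0) = ∑ τ, f (insertPerm i j τ) := by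
  rw [← Finset.sum_filter]
  symm
  refine Finset.sum_bij (fun τ _ => insertPerm i j τ) ?_ ?_ ?_ ?_
  · intro τ _; simp
  · intro τ _ τ' _ h; exact insertPerm_injective i j h
  · intro σ hσ
    obtain ⟨τ, hτ⟩ := exists_insertPerm (Finset.mem_filter.1 hσ).2
    exact ⟨τ, Finset.mem_univ _, hτ⟩
  · intros; rfl

lemma permInv_eq_sum {n : ℕ} (σ : Equiv.Perm (Fin n)) :
    permInv σ = ∑ p, ∑ r, if p < r ∧ σ r < σ p then 1 else 0 := by
  rw [permInv, Finset.card_filter, Fintype.sum_prod_type]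

/-- The inserted entry forms inversions with the entries to its lower left and upper right. -/
lemma permInv_insertPerm {n : ℕ} (i j : Fin (n + 1)) (τ : Equiv.Perm (Fin n)) :
    permInv (insertPerm i j τ) = permInv τ
      + ∑ k, (if i < i.succAbove k ∧ j.succAbove (τ k) < j then 1 else 0)
      + ∑ k, (if i.succAbove k < i ∧ j < j.succAbove (τ k) then 1 else 0) := by
  rw [permInv_eq_sum, permInv_eq_sum, Fin.sum_univ_succAbove _ i]
  simp only [Fin.sum_univ_succAbove _ i, insertPerm_apply_self, insertPerm_apply_succAbove,
    lt_irrefl, false_and, if_false, zero_add, Fin.succAbove_lt_succAbove_iff,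
    Finset.sum_add_distrib]
  ring

lemma card_perm_lt {n : ℕ} (τ : Equiv.Perm (Fin n)) {b : ℕ} (hb : b ≤ n) :
    ∑ k, (if (τ k : ℕ) < b then 1 else 0) = b := by
  rw [Equiv.sum_comp τ (fun k : Fin n => if (k : ℕ) < b then 1 else 0),
    Fin.sum_univ_eq_sum_range (fun k => if k < b then 1 else 0), ← Finset.sum_filter]
  have : (Finset.range n).filter (· < b) = Finset.range b := by
    ext k; simp; omega
  simp [this]

lemma val_succAbove {n : ℕ} (i : Fin (n + 1)) (k : Fin n) :
    (i.succAbove k : ℕ) = if (k : ℕ) < i then (k : ℕ) else k + 1 := by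
  unfold Fin.succAbove
  simp only [Fin.lt_def, Fin.val_castSucc]
  split_ifs <;> simp

/-- Deleting one of the first `a` rows together with the first admissible column shortens the
forbidden corner by one row. -/
lemma avoidsCorner_insertPerm {n a : ℕ} (i j : Fin (n + 1)) (hi : (i : ℕ) < a)
    (τ : Equiv.Perm (Fin n)) :
    AvoidsCorner a j (insertPerm i j τ) ↔ AvoidsCorner (a - 1) j τ := by
  constructor
  · intro h k hk
    have h1 := h (i.succAbove k)
    rw [insertPerm_apply_succAbove, val_succAbove, val_succAbove] at h1
    split_ifs at h1 <;> omega
  · intro h r hr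
    rcases Fin.eq_self_or_eq_succAbove i r with rfl | ⟨k, rfl⟩
    · simp
    · rw [insertPerm_apply_succAbove, val_succAbove]
      rw [val_succAbove] at hr
      have h1 := h k
      split_ifs at hr ⊢ <;> omega

/-- Every value below `j` lies to the lower left of the new entry, and every row above `i` to its
upper right, so the number of new inversions does not depend on `τ`. -/
lemma permInv_insertPerm_of_avoidsCorner {n a : ℕ} (i j : Fin (n + 1)) (hi : (i : ℕ) < a)
    (τ : Equiv.Perm (Fin n)) (h : AvoidsCorner (a - 1) j τ) :
    permInv (insertPerm i j τ) = permInv τ + j + i := by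
  rw [permInv_insertPerm]
  have hl : ∀ k, (i < i.succAbove k ∧ j.succAbove (τ k) < j) ↔ (τ k : ℕ) < j := by
    intro k
    have h1 := h k
    rw [Fin.lt_def, Fin.lt_def, val_succAbove, val_succAbove]
    split_ifs <;> omega
  have hu : ∀ k, (i.succAbove k < i ∧ j < j.succAbove (τ k)) ↔
      (Equiv.refl (Fin n) k : ℕ) < i := by
    intro k
    have h1 := h k
    rw [Fin.lt_def, Fin.lt_def, val_succAbove, val_succAbove, Equiv.refl_apply]
    split_ifs <;> omega
  simp only [hl, hu]
  rw [card_perm_lt τ (by omega), card_perm_lt (Equiv.refl (Fin n)) (by omega)]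

/-- An entry inside the clamped square contributes nothing to the clamped footrule, and deleting
it lowers the clamp by one. For `c = 0` the truncated subtraction gives the correct value. -/
lemma clampedNa_insertPerm {n c : ℕ} (i j : Fin (n + 1)) (hi : (i : ℕ) ≤ c) (hj : (j : ℕ) ≤ c)
    (τ : Equiv.Perm (Fin n)) : clampedNa c (insertPerm i j τ) = clampedNa (c - 1) τ := by
  rw [clampedNa, clampedNa, Fin.sum_univ_succAbove _ i, insertPerm_apply_self,
    max_eq_right hi, max_eq_right hj, sub_self, Int.natAbs_zero, zero_add]
  refine Finset.sum_congr rfl fun k _ => ?_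
  rw [insertPerm_apply_succAbove, val_succAbove, val_succAbove]
  split_ifs <;> omega

section
variable {R : Type*} [CommSemiring R]

/-- The weight `q ^ inv * t ^ na` summed over the permutations of `n` letters that avoid the
`a × b` corner, with the footrule clamped at `c`. -/
def cornerSum (q t : R) (n c a b : ℕ) : R :=
  ∑ σ : Equiv.Perm (Fin n),
    if AvoidsCorner a b σ then q ^ permInv σ * t ^ clampedNa c σ else 0

lemma permInv_symm {n : ℕ} (σ : Equiv.Perm (Fin n)) : permInv σ⁻¹ = permInv σ := by
  rw [permInv_eq_sum, permInv_eq_sum, Finset.sum_comm, ← Equiv.sum_comp σ]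
  refine Finset.sum_congr rfl fun p _ => ?_
  rw [← Equiv.sum_comp σ]
  refine Finset.sum_congr rfl fun r _ => ?_
  simp [and_comm]

lemma clampedNa_symm (c : ℕ) {n : ℕ} (σ : Equiv.Perm (Fin n)) :
    clampedNa c σ⁻¹ = clampedNa c σ := by
  rw [clampedNa, clampedNa, ← Equiv.sum_comp σ]
  refine Finset.sum_congr rfl fun p _ => ?_
  rw [show σ⁻¹ (σ p) = p by simp]
  omega

lemma avoidsCorner_symm {a b n : ℕ} (σ : Equiv.Perm (Fin n)) :
    AvoidsCorner b a σ⁻¹ ↔ AvoidsCorner a b σ := by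
  constructor
  · intro h i hi
    by_contra hlt
    have := h (σ i) (by omega)
    rw [show σ⁻¹ (σ i) = i by simp] at this
    omega
  · intro h i hi
    by_contra hlt
    have := h (σ⁻¹ i) (by omega)
    rw [show σ (σ⁻¹ i) = i by simp] at this
    omega

lemma cornerSum_comm (q t : R) (n c a b : ℕ) : cornerSum q t n c a b = cornerSum q t n c b a := by
  rw [cornerSum, cornerSum, ← Equiv.sum_comp (Equiv.inv (Equiv.Perm (Fin n)))]
  refine Finset.sum_congr rfl fun σ _ => ?_
  simp only [Equiv.inv_apply, permInv_symm, clampedNa_symm, avoidsCorner_symm]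

/-- Classify the permutations avoiding the `a × b` corner by whether column `b` is hit by one
of the first `a` rows; if it is, delete that entry. -/
lemma cornerSum_succ (q t : R) {n c a b : ℕ} (hb : b ≤ n) (ha : a ≤ n + 1) (hbc : b ≤ c)
    (hac : a ≤ c + 1) :
    cornerSum q t (n + 1) c a b = cornerSum q t (n + 1) c a (b + 1)
      + q ^ b * (∑ i ∈ Finset.range a, q ^ i) * cornerSum q t n (c - 1) (a - 1) b := by
  classical
  let j : Fin (n + 1) := ⟨b, by omega⟩
  let f : Equiv.Perm (Fin (n + 1)) → R := fun σ => q ^ permInv σ * t ^ clampedNa c σ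
  have h1 : ∀ σ : Equiv.Perm (Fin (n + 1)),
      (if AvoidsCorner a b σ then f σ else 0) = (if AvoidsCorner a (b + 1) σ then f σ else 0)
        + ∑ i : Fin (n + 1), if (i : ℕ) < a then
            (if σ i = j then (if AvoidsCorner a b σ then f σ else 0) else 0) else 0 := by
    intro σ
    by_cases hA : AvoidsCorner a b σ
    · by_cases hB : AvoidsCorner a (b + 1) σ
      · rw [if_pos hA, if_pos hB, Finset.sum_eq_zero, add_zero]
        intro i _
        by_cases hi : (i : ℕ) < a
        · have := hB i hi
          rw [if_pos hi, if_neg]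
          intro h
          rw [h] at this
          exact absurd this (by simp [j])
        · rw [if_neg hi]
      · rw [if_neg hB, zero_add]
        have hB' : ∃ i : Fin (n + 1), (i : ℕ) < a ∧ (σ i : ℕ) < b + 1 := by
          by_contra hcon
          push Not at hcon
          exact hB hcon
        obtain ⟨i, hi, hib⟩ := hB'
        have hij : σ i = j := Fin.ext (by have := hA i hi; simp only [j]; omega)
        rw [Finset.sum_eq_single i]
        · simp [hi, hij]
        · intro i' _ hne
          have : σ i' ≠ j := fun h => hne (σ.injective (h.trans hij.symm))
          simp [this]
        · simp
    · have hB : ¬ AvoidsCorner a (b + 1) σ := fun h => hA fun i hi => (Nat.le_succ b).trans (h i hi)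
      simp [hA, hB]
  have h2 : ∀ i : Fin (n + 1), (i : ℕ) < a →
      ∑ σ, (if σ i = j then (if AvoidsCorner a b σ then f σ else 0) else 0)
        = q ^ b * q ^ (i : ℕ) * cornerSum q t n (c - 1) (a - 1) b := by
    intro i hi
    rw [sum_perm_eq_sum_insertPerm i j (fun σ => if AvoidsCorner a b σ then f σ else 0),
      cornerSum, Finset.mul_sum]
    refine Finset.sum_congr rfl fun τ _ => ?_
    have h3 : AvoidsCorner a b (insertPerm i j τ) ↔ AvoidsCorner (a - 1) b τ :=
      avoidsCorner_insertPerm i j hi τ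
    by_cases hτ : AvoidsCorner (a - 1) b τ
    · have h4 : permInv (insertPerm i j τ) = permInv τ + b + i :=
        permInv_insertPerm_of_avoidsCorner i j hi τ hτ
      rw [if_pos (h3.2 hτ), if_pos hτ]
      simp only [f]
      rw [h4, clampedNa_insertPerm i j (by omega) hbc, pow_add, pow_add]
      ring
    · rw [if_neg (h3.not.2 hτ), if_neg hτ, mul_zero]
  rw [cornerSum, cornerSum, Finset.sum_congr rfl fun σ _ => h1 σ, Finset.sum_add_distrib,
    Finset.sum_comm]
  congr 1
  have h5 : ∀ i : Fin (n + 1), ∑ σ, (if (i : ℕ) < a then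
      (if σ i = j then (if AvoidsCorner a b σ then f σ else 0) else 0) else 0)
      = if (i : ℕ) < a then q ^ b * q ^ (i : ℕ) * cornerSum q t n (c - 1) (a - 1) b else 0 := by
    intro i
    split_ifs with hi
    · exact h2 i hi
    · simp
  rw [Finset.sum_congr rfl fun i _ => h5 i,
    Fin.sum_univ_eq_sum_range (fun i => if i < a then
      q ^ b * q ^ i * cornerSum q t n (c - 1) (a - 1) b else 0), ← Finset.sum_filter]
  have h6 : (Finset.range (n + 1)).filter (· < a) = Finset.range a := by
    ext k; simp; omega
  rw [h6, Finset.mul_sum, Finset.sum_mul]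

/-- If the `c × c` corner is avoided, the cut in front of index `c` is crossed by exactly `c`
rows and `c` columns. -/
lemma cornerSum_pred (q t : R) {n c : ℕ} (hc : c ≤ n) :
    cornerSum q t n (c - 1) c c = t ^ (2 * c) * cornerSum q t n c c c := by
  rw [cornerSum, cornerSum, Finset.mul_sum]
  refine Finset.sum_congr rfl fun σ _ => ?_
  split_ifs with h
  · have h1 : clampedNa (c - 1) σ = clampedNa c σ
        + ∑ i, (if (Equiv.refl (Fin n) i : ℕ) < c then 1 else 0)
        + ∑ i, (if (σ i : ℕ) < c then 1 else 0) := by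
      rw [clampedNa, clampedNa, ← Finset.sum_add_distrib, ← Finset.sum_add_distrib]
      refine Finset.sum_congr rfl fun i _ => ?_
      have := h i
      rw [Equiv.refl_apply]
      split_ifs <;> omega
    rw [card_perm_lt _ hc, card_perm_lt _ hc] at h1
    rw [h1, pow_add, pow_add, two_mul, pow_add]
    ring
  · simp

/-- The generating function of the permutations of `n + h` letters that avoid the `h × h`
corner: `h` rows and `h` columns are still open, and `n` indices remain to be processed. The clamp
`h - 1` accounts for the open entries crossing the cut in front of index `h`. -/
def openSum (q t : R) (n h : ℕ) : R := cornerSum q t (n + h) (h - 1) h h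

lemma openSum_zero (q t : R) (n : ℕ) :
    openSum q t n 0 = ∑ π : Equiv.Perm (Fin n), q ^ permInv π * t ^ permNa π := by
  simp [openSum, cornerSum, AvoidsCorner, clampedNa, permNa]

lemma openSum_zero_left (q t : R) (h : ℕ) : openSum q t 0 h = if h = 0 then 1 else 0 := by
  rcases Nat.eq_zero_or_pos h with rfl | hh
  · rw [openSum_zero]
    simp [permInv, permNa]
  · rw [if_neg (by omega), openSum, cornerSum]
    refine Finset.sum_eq_zero fun σ _ => if_neg fun hσ => ?_
    have := hσ ⟨0, by omega⟩ hh
    omega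

/-- The three-term recurrence, obtained by processing column `h` and then row `h`. -/
lemma openSum_succ (q t : R) (n h : ℕ) :
    openSum q t (n + 1) h = t ^ (2 * h) * (openSum q t n (h + 1)
      + q ^ h * (∑ i ∈ Finset.range h, q ^ i + ∑ i ∈ Finset.range (h + 1), q ^ i)
          * openSum q t n h
      + q ^ (2 * h - 1) * (∑ i ∈ Finset.range h, q ^ i) ^ 2 * openSum q t n (h - 1)) := by
  have e1 : openSum q t (n + 1) h = t ^ (2 * h) * cornerSum q t (n + h + 1) h h h := by
    rw [openSum, show n + 1 + h = n + h + 1 by ring, cornerSum_pred _ _ (by omega)]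
  have e2 := cornerSum_succ q t (n := n + h) (c := h) (a := h) (b := h) (by omega) (by omega)
    le_rfl (by omega)
  have e3 := cornerSum_succ q t (n := n + h) (c := h) (a := h + 1) (b := h) (by omega)
    (by omega) le_rfl (by omega)
  rw [cornerSum_comm q t (n + h + 1) h (h + 1) h] at e3
  have e4 : openSum q t n (h + 1) = cornerSum q t (n + h + 1) h (h + 1) (h + 1) := rfl
  rw [e1, e2, e3, e4]
  simp only [Nat.add_sub_cancel]
  rcases h with _ | h
  · simp [openSum]
  · have e5 := cornerSum_succ q t (n := n + h) (c := h) (a := h + 1) (b := h) (by omega)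
      (by omega) le_rfl (by omega)
    rw [cornerSum_comm q t (n + h + 1) h (h + 1) h] at e5
    have e6 : openSum q t n (h + 1) = cornerSum q t (n + h + 1) h (h + 1) (h + 1) := rfl
    have e7 : openSum q t n h = cornerSum q t (n + h) (h - 1) h h := rfl
    simp only [Nat.add_sub_cancel] at e5 ⊢
    rw [show n + (h + 1) = n + h + 1 by ring, e5, e6, e7,
      show 2 * (h + 1) - 1 = (h + 1) + h by omega, pow_add q (h + 1) h]
    ring
end

/-! ### Polynomial solutions of the Laguerre recurrence -/

/-- Sequences of rationals given by a polynomial of degree at most `d`. -/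
def IsPolySeq (d : ℕ) (f : ℕ → ℚ) : Prop :=
  ∃ p : Polynomial ℚ, p.natDegree ≤ d ∧ ∀ n : ℕ, f n = p.eval (n : ℚ)

namespace IsPolySeq
open Polynomial

lemma mono {d e : ℕ} {f : ℕ → ℚ} (hf : IsPolySeq d f) (h : d ≤ e) : IsPolySeq e f := by
  obtain ⟨p, hp, hpf⟩ := hf
  exact ⟨p, hp.trans h, hpf⟩

lemma congr {d : ℕ} {f g : ℕ → ℚ} (hf : IsPolySeq d f) (h : ∀ n, g n = f n) :
    IsPolySeq d g := by
  rwa [funext h]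

lemma const (c : ℚ) : IsPolySeq 0 fun _ => c :=
  ⟨C c, by simp, by simp⟩

lemma natCast : IsPolySeq 1 fun n => (n : ℚ) :=
  ⟨X, by simp, by simp⟩

lemma add {d : ℕ} {f g : ℕ → ℚ} (hf : IsPolySeq d f) (hg : IsPolySeq d g) :
    IsPolySeq d fun n => f n + g n := by
  obtain ⟨p, hp, hpf⟩ := hf
  obtain ⟨r, hr, hrg⟩ := hg
  exact ⟨p + r, natDegree_add_le_of_degree_le hp hr, fun n => by simp [hpf, hrg]⟩

lemma mul {d e : ℕ} {f g : ℕ → ℚ} (hf : IsPolySeq d f) (hg : IsPolySeq e g) :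
    IsPolySeq (d + e) fun n => f n * g n := by
  obtain ⟨p, hp, hpf⟩ := hf
  obtain ⟨r, hr, hrg⟩ := hg
  exact ⟨p * r, natDegree_mul_le_of_le hp hr, fun n => by simp [hpf, hrg]⟩

lemma const_mul {d : ℕ} {f : ℕ → ℚ} (c : ℚ) (hf : IsPolySeq d f) :
    IsPolySeq d fun n => c * f n := by
  simpa using (const c).mul hf

lemma sum {ι : Type*} {d : ℕ} {f : ι → ℕ → ℚ} (s : Finset ι) (hf : ∀ i ∈ s, IsPolySeq d (f i)) :
    IsPolySeq d fun n => ∑ i ∈ s, f i n := by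
  classical
  induction s using Finset.induction_on with
  | empty => simpa using (const 0).mono (Nat.zero_le d)
  | insert a s ha ih =>
    simp only [Finset.sum_insert ha]
    exact (hf a (Finset.mem_insert_self a s)).add
      (ih fun i hi => hf i (Finset.mem_insert_of_mem hi))

lemma comp_linear {d : ℕ} {f : ℕ → ℚ} (hf : IsPolySeq d f) (a b : ℕ) :
    IsPolySeq d fun n => f (a * n + b) := by
  obtain ⟨p, hp, hpf⟩ := hf
  refine ⟨p.comp (C (a : ℚ) * X + C (b : ℚ)), ?_, fun n => by simp [hpf]⟩
  refine natDegree_comp_le.trans ?_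
  calc p.natDegree * (C (a : ℚ) * X + C (b : ℚ)).natDegree ≤ d * 1 :=
        Nat.mul_le_mul hp natDegree_linear_le
    _ = d := mul_one d

lemma choose (k : ℕ) : IsPolySeq k fun n => (n.choose k : ℚ) := by
  refine ⟨C ((k.factorial : ℚ)⁻¹) * descPochhammer ℚ k, ?_, fun n => ?_⟩
  · exact (natDegree_C_mul_le _ _).trans (descPochhammer_natDegree ℚ k).le
  · simp only [Nat.cast_choose_eq_descPochhammer_div, eval_mul, eval_C]
    ring

/-- A polynomial sequence shifted to start at index `1` extends to a polynomial sequence. -/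
lemma exists_of_succ {d : ℕ} {f : ℕ → ℚ} (hf : IsPolySeq d f) :
    ∃ g : ℕ → ℚ, IsPolySeq d g ∧ ∀ n, g (n + 1) = f n := by
  obtain ⟨p, hp, hpf⟩ := hf
  refine ⟨fun n => (p.comp (X - C 1)).eval (n : ℚ), ⟨_, ?_, fun n => rfl⟩, fun n => ?_⟩
  · refine natDegree_comp_le.trans ?_
    calc p.natDegree * (X - C (1 : ℚ)).natDegree ≤ d * 1 :=
        Nat.mul_le_mul hp (natDegree_X_sub_C _).le
      _ = d := mul_one d
  · simp [hpf]

end IsPolySeq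

section
open Polynomial

lemma exists_polynomial_eq_sum_range (p : ℚ[X]) :
    ∃ P : ℚ[X], P.natDegree ≤ p.natDegree + 1 ∧
      ∀ n : ℕ, P.eval (n : ℚ) = ∑ l ∈ Finset.range n, p.eval (l : ℚ) := by
  have hpow : ∀ k : ℕ, IsPolySeq (k + 1) fun n => ∑ l ∈ Finset.range n, (l : ℚ) ^ k := by
    intro k
    simp only [sum_range_pow]
    refine IsPolySeq.sum _ fun i _ => ?_
    refine ⟨C (_root_.bernoulli i * ((k + 1).choose i : ℚ) / (k + 1)) * X ^ (k + 1 - i), ?_, ?_⟩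
    · exact (natDegree_C_mul_X_pow_le _ _).trans (by omega)
    · intro n
      simp
      ring
  have h : IsPolySeq (p.natDegree + 1) fun n => ∑ l ∈ Finset.range n, p.eval (l : ℚ) := by
    simp only [eval_eq_sum_range]
    have := IsPolySeq.sum (d := p.natDegree + 1)
      (f := fun k n => p.coeff k * ∑ l ∈ Finset.range n, (l : ℚ) ^ k)
      (Finset.range (p.natDegree + 1)) fun k hk =>
        ((hpow k).const_mul (p.coeff k)).mono (by have := Finset.mem_range.1 hk; omega)
    convert this using 2 with n
    rw [Finset.sum_comm]
    simp only [Finset.mul_sum]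
  obtain ⟨P, hP, hPn⟩ := h
  exact ⟨P, hP, fun n => (hPn n).symm⟩

/-- The number `m! * m (m - 1) ⋯ (m - h + 1)` of permutations of `m + h` letters that avoid the
`h × h` corner. -/
def openCount (m h : ℕ) : ℚ := (m.factorial : ℚ) * (m.descFactorial h : ℚ)

lemma openCount_mul (m h : ℕ) : (h : ℚ) * openCount m h
    = m * openCount m h - (m : ℚ) ^ 2 * openCount (m - 1) h := by
  rcases m with _ | m
  · rcases h with _ | h <;> simp [openCount]
  · have h1 : ((m + 1).descFactorial (h + 1) : ℚ) = (m + 1) * m.descFactorial h := by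
      rw [Nat.succ_descFactorial_succ]; push_cast; ring
    have h2 : ((m + 1).descFactorial (h + 1) : ℚ) = (m + 1 - h) * (m + 1).descFactorial h := by
      rw [Nat.descFactorial_succ]
      rcases le_or_gt h (m + 1) with hh | hh
      · push_cast [Nat.cast_sub hh]; ring
      · simp [Nat.descFactorial_of_lt hh]
    simp only [openCount, Nat.add_sub_cancel, Nat.factorial_succ]
    push_cast
    linear_combination (-((m : ℚ) + 1) * m.factorial) * (h1 - h2)

lemma openCount_succ_right (m h : ℕ) :
    openCount m (h + 1) = (m : ℚ) ^ 2 * openCount (m - 1) h := by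
  rcases m with _ | m
  · simp [openCount]
  · simp only [openCount, Nat.add_sub_cancel, Nat.factorial_succ, Nat.succ_descFactorial_succ]
    push_cast
    ring

lemma openCount_pred_right (m h : ℕ) : (h : ℚ) ^ 2 * openCount m (h - 1)
    = openCount (m + 1) h - (2 * m + 1) * openCount m h + (m : ℚ) ^ 2 * openCount (m - 1) h := by
  have h0 := openCount_mul m h
  rcases h with _ | h
  · have e : openCount (m + 1) 0 = (m + 1) * openCount m 0 := by
      simp [openCount, Nat.factorial_succ]
    rw [e]
    push_cast at h0 ⊢
    linear_combination -h0
  · have h2 := openCount_succ_right (m + 1) h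
    have h3 := openCount_succ_right m h
    have h4 := openCount_mul m h
    simp only [Nat.add_sub_cancel] at *
    push_cast at *
    linear_combination -h2 - h0 + (h + m + 2) * h4 + (h + m + 2) * h3

/-- The level step `2 h + 1`, the up step and the down step `h ^ 2` add up to the three-term
recurrence of the counts, which is that of the Laguerre polynomials. -/
lemma openCount_succ_left (m h : ℕ) : openCount (m + 1) h
    = openCount m (h + 1) + (2 * h + 1) * openCount m h + (h : ℚ) ^ 2 * openCount m (h - 1) := by
  linear_combination -openCount_pred_right m h - openCount_succ_right m h - 2 * openCount_mul m h
end

/-- The functions `(n, h) ↦ p n * openCount (n + s - k) h`, where `k ≤ K`, the polynomial `p` has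
degree at most `d + k`, and `p` vanishes wherever the subtraction is truncated. -/
def lagGenerators (s d K : ℕ) : Set (ℕ → ℕ → ℚ) :=
  {F | ∃ (p : Polynomial ℚ) (k : ℕ), k ≤ K ∧ p.natDegree ≤ d + k ∧
    (∀ n : ℕ, n + s < k → p.eval (n : ℚ) = 0) ∧
    F = fun n h : ℕ => p.eval (n : ℚ) * openCount (n + s - k) h}

/-- The space of functions spanned by `lagGenerators s d K`. -/
def lagSpan (s d K : ℕ) : Submodule ℚ (ℕ → ℕ → ℚ) := Submodule.span ℚ (lagGenerators s d K)

namespace lagSpan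
open Polynomial

lemma mono {s d K d' K' : ℕ} (hd : d ≤ d') (hK : K ≤ K') : lagSpan s d K ≤ lagSpan s d' K' := by
  refine Submodule.span_mono ?_
  rintro F ⟨p, k, hk, hp, h0, rfl⟩
  exact ⟨p, k, hk.trans hK, by omega, h0, rfl⟩

/-- A linear operator maps one span into another as soon as it does so on generators. -/
lemma map_mem {s d K : ℕ} {N : Submodule ℚ (ℕ → ℕ → ℚ)}
    (T : (ℕ → ℕ → ℚ) →ₗ[ℚ] (ℕ → ℕ → ℚ))
    (hT : ∀ (p : ℚ[X]) (k : ℕ), k ≤ K → p.natDegree ≤ d + k →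
      (∀ n : ℕ, n + s < k → p.eval (n : ℚ) = 0) →
      T (fun n h : ℕ => p.eval (n : ℚ) * openCount (n + s - k) h) ∈ N)
    {F : ℕ → ℕ → ℚ} (hF : F ∈ lagSpan s d K) : T F ∈ N := by
  have : lagSpan s d K ≤ N.comap T := by
    refine Submodule.span_le.2 ?_
    rintro F ⟨p, k, hk, hp, h0, rfl⟩
    exact hT p k hk hp h0
  exact this hF

lemma generator_mem {s d K : ℕ} {p : ℚ[X]} {k : ℕ} (hk : k ≤ K) (hp : p.natDegree ≤ d + k)
    (h0 : ∀ n : ℕ, n + s < k → p.eval (n : ℚ) = 0) :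
    (fun n h : ℕ => p.eval (n : ℚ) * openCount (n + s - k) h) ∈ lagSpan s d K :=
  Submodule.subset_span ⟨p, k, hk, hp, h0, rfl⟩

lemma natDegree_mul_linear_pow_le {p : ℚ[X]} {d : ℕ} (hp : p.natDegree ≤ d) (c : ℚ) (m : ℕ) :
    (p * (X + C c) ^ m).natDegree ≤ d + m := by
  refine natDegree_mul_le_of_le hp ?_
  exact (natDegree_pow_le_of_le m (natDegree_X_add_C c).le).trans (by omega)

lemma height_mul_mem {s d K : ℕ} {F : ℕ → ℕ → ℚ} (hF : F ∈ lagSpan s d K) :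
    (fun n h : ℕ => (h : ℚ) * F n h) ∈ lagSpan s (d + 1) (K + 1) := by
  let T : (ℕ → ℕ → ℚ) →ₗ[ℚ] (ℕ → ℕ → ℚ) :=
    { toFun := fun F n h => (h : ℚ) * F n h
      map_add' := fun F G => by ext; simp [mul_add]
      map_smul' := fun c F => by ext; simp; ring }
  refine map_mem T (fun p k hk hp h0 => ?_) hF
  have e : T (fun n h : ℕ => p.eval (n : ℚ) * openCount (n + s - k) h)
      = (fun n h : ℕ => (p * (X + C ((s : ℚ) - k)) ^ 1).eval (n : ℚ) * openCount (n + s - k) h)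
        - fun n h : ℕ => (p * (X + C ((s : ℚ) - k)) ^ 2).eval (n : ℚ)
            * openCount (n + s - (k + 1)) h := by
    ext n h
    simp only [T, LinearMap.coe_mk, AddHom.coe_mk, Pi.sub_apply, eval_mul, eval_pow, eval_add,
      eval_X, eval_C]
    rcases lt_or_ge (n + s) k with hlt | hge
    · simp [h0 n hlt]
    · have := openCount_mul (n + s - k) h
      rw [Nat.sub_sub, Nat.cast_sub hge] at this
      push_cast at this
      linear_combination p.eval (n : ℚ) * this
  rw [e]
  refine Submodule.sub_mem _ (generator_mem (by omega) ?_ ?_) (generator_mem (by omega) ?_ ?_)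
  · exact (natDegree_mul_linear_pow_le hp _ 1).trans (by omega)
  · intro n hn
    simp [h0 n hn]
  · exact (natDegree_mul_linear_pow_le hp _ 2).trans (by omega)
  · intro n hn
    rcases Nat.lt_or_ge (n + s) k with hlt | hge
    · simp [h0 n hlt]
    · have : (k : ℚ) = n + s := by exact_mod_cast (show k = n + s by omega)
      simp [this]

lemma polySeq_mul_mem {s d K a : ℕ} {F : ℕ → ℕ → ℚ} {f : ℕ → ℚ} (hf : IsPolySeq a f)
    (hF : F ∈ lagSpan s d K) : (fun n h : ℕ => f h * F n h) ∈ lagSpan s (d + a) (K + a) := by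
  have hpow : ∀ k, (fun n h : ℕ => (h : ℚ) ^ k * F n h) ∈ lagSpan s (d + k) (K + k) := by
    intro k
    induction k with
    | zero => simpa using hF
    | succ k ih =>
      have e : (fun n h : ℕ => (h : ℚ) ^ (k + 1) * F n h)
          = fun n h : ℕ => (h : ℚ) * ((h : ℚ) ^ k * F n h) := by
        ext n h
        ring
      rw [e]
      exact height_mul_mem ih
  obtain ⟨p, hp, hpf⟩ := hf
  have e : (fun n h : ℕ => f h * F n h)
      = ∑ k ∈ Finset.range (a + 1), p.coeff k • fun n h : ℕ => ((h : ℕ) : ℚ) ^ k * F n h := by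
    ext n h
    rw [hpf, eval_eq_sum_range' (Nat.lt_succ_of_le hp), Finset.sum_mul]
    simp [Finset.sum_apply, mul_assoc]
  rw [e]
  refine Submodule.sum_mem _ fun k hk => Submodule.smul_mem _ _ ?_
  have := Finset.mem_range.1 hk
  exact mono (by omega) (by omega) (hpow k)

lemma shift_mem {d K : ℕ} {F : ℕ → ℕ → ℚ} (hF : F ∈ lagSpan 0 (d + 1) K) :
    F ∈ lagSpan 1 d (K + 1) := by
  refine map_mem LinearMap.id (fun p k hk hp h0 => ?_) hF
  have := generator_mem (s := 1) (d := d) (K := K + 1) (p := p) (k := k + 1) (by omega)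
    (by omega) (fun n hn => h0 n (by omega))
  simpa only [LinearMap.id_apply, Nat.add_sub_add_right, add_zero] using this

lemma up_mem {d K : ℕ} {F : ℕ → ℕ → ℚ} (hF : F ∈ lagSpan 0 d K) :
    (fun n h : ℕ => F n (h + 1)) ∈ lagSpan 0 (d + 1) (K + 1) := by
  let T : (ℕ → ℕ → ℚ) →ₗ[ℚ] (ℕ → ℕ → ℚ) :=
    { toFun := fun F n h => F n (h + 1)
      map_add' := fun F G => by ext; simp
      map_smul' := fun c F => by ext; simp }
  refine map_mem T (fun p k hk hp h0 => ?_) hF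
  have e : T (fun n h : ℕ => p.eval (n : ℚ) * openCount (n + 0 - k) h)
      = fun n h : ℕ =>
        (p * (X + C (-(k : ℚ))) ^ 2).eval (n : ℚ) * openCount (n + 0 - (k + 1)) h := by
    ext n h
    simp only [T, LinearMap.coe_mk, AddHom.coe_mk, eval_mul, eval_pow, eval_add, eval_X, eval_C]
    rcases lt_or_ge n k with hlt | hge
    · simp [h0 n hlt]
    · rw [openCount_succ_right, Nat.sub_sub, add_zero, Nat.cast_sub hge]
      ring
  rw [e]
  refine generator_mem (by omega) ?_ ?_
  · exact (natDegree_mul_linear_pow_le hp _ 2).trans (by omega)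
  · intro n hn
    rcases Nat.lt_or_ge n k with hlt | hge
    · simp [h0 n hlt]
    · have : (k : ℚ) = n := by exact_mod_cast (show k = n by omega)
      simp [this]

lemma down_mem {d K : ℕ} {F : ℕ → ℕ → ℚ} (hF : F ∈ lagSpan 0 d K) :
    (fun n h : ℕ => (h : ℚ) ^ 2 * F n (h - 1)) ∈ lagSpan 1 d (K + 2) := by
  let T : (ℕ → ℕ → ℚ) →ₗ[ℚ] (ℕ → ℕ → ℚ) :=
    { toFun := fun F n h => (h : ℚ) ^ 2 * F n (h - 1)
      map_add' := fun F G => by ext; simp [mul_add]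
      map_smul' := fun c F => by ext; simp; ring }
  refine map_mem T (fun p k hk hp h0 => ?_) hF
  have e : T (fun n h : ℕ => p.eval (n : ℚ) * openCount (n + 0 - k) h)
      = (fun n h : ℕ => p.eval (n : ℚ) * openCount (n + 1 - k) h)
        - (2 : ℚ) • (fun n h : ℕ => (p * (X + C (-(k : ℚ) + 1 / 2)) ^ 1).eval (n : ℚ)
            * openCount (n + 1 - (k + 1)) h)
        + fun n h : ℕ => (p * (X + C (-(k : ℚ))) ^ 2).eval (n : ℚ)
            * openCount (n + 1 - (k + 2)) h := by
    ext n h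
    simp only [T, LinearMap.coe_mk, AddHom.coe_mk, eval_mul, eval_pow, eval_add, eval_X, eval_C,
      Pi.add_apply, Pi.sub_apply, Pi.smul_apply, smul_eq_mul]
    rcases lt_or_ge n k with hlt | hge
    · simp [h0 n hlt]
    · have := openCount_pred_right (n - k) h
      rw [Nat.cast_sub hge, show n - k + 1 = n + 1 - k by omega] at this
      rw [show n + 1 - (k + 1) = n - k by omega, show n + 1 - (k + 2) = n - k - 1 by omega,
        show n + 0 - k = n - k by omega]
      linear_combination p.eval (n : ℚ) * this
  rw [e]
  refine Submodule.add_mem _ (Submodule.sub_mem _ (generator_mem (by omega) hp ?_)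
    (Submodule.smul_mem _ _ (generator_mem (by omega) ?_ ?_))) (generator_mem (by omega) ?_ ?_)
  · intro n hn
    exact h0 n (by omega)
  · exact (natDegree_mul_linear_pow_le hp _ 1).trans (by omega)
  · intro n hn
    simp [h0 n (by omega)]
  · exact (natDegree_mul_linear_pow_le hp _ 2).trans (by omega)
  · intro n hn
    rcases Nat.lt_or_ge n k with hlt | hge
    · simp [h0 n hlt]
    · have : (k : ℚ) = n := by exact_mod_cast (show k = n by omega)
      simp [this]

/-- `Z` solves the three-term recurrence of `openCount` with source term `G`. -/
def SolvesWithSource (Z G : ℕ → ℕ → ℚ) : Prop :=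
  ∀ n h, Z (n + 1) h
    = Z n (h + 1) + (2 * h + 1) * Z n h + (h : ℚ) ^ 2 * Z n (h - 1) + G n h

/-- Summing the source over time solves the recurrence with zero initial values, at the cost of
one degree: the coefficient of each `openCount (n - k)` is an indefinite sum. -/
lemma exists_solution {d K : ℕ} {G : ℕ → ℕ → ℚ} (hG : G ∈ lagSpan 1 d K) :
    ∃ Z ∈ lagSpan 0 (d + 1) K, (∀ h, Z 0 h = 0) ∧ SolvesWithSource Z G := by
  induction hG using Submodule.span_induction with
  | mem G hG =>
    obtain ⟨p, k, hk, hp, h0, rfl⟩ := hG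
    obtain ⟨P, hPd, hP⟩ := exists_polynomial_eq_sum_range p
    have hP0 : ∀ n : ℕ, n + 0 < k → P.eval (n : ℚ) = 0 := by
      intro n hn
      rw [hP]
      exact Finset.sum_eq_zero fun l hl => h0 l (by have := Finset.mem_range.1 hl; omega)
    refine ⟨_, generator_mem (p := P) hk (by omega) hP0, ?_, ?_⟩
    · intro h
      have := hP 0
      simp only [Nat.cast_zero, Finset.range_zero, Finset.sum_empty] at this
      simp [this]
    · intro n h
      have h1 : P.eval ((n + 1 : ℕ) : ℚ) = P.eval (n : ℚ) + p.eval (n : ℚ) := by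
        rw [hP, hP, Finset.sum_range_succ]
      simp only [h1]
      rcases lt_or_ge n k with hlt | hge
      · rw [hP0 n hlt]
        simp
      · have h2 := openCount_succ_left (n - k) h
        rw [show n + 1 + 0 - k = n - k + 1 by omega, show n + 0 - k = n - k by omega]
        linear_combination P.eval (n : ℚ) * h2
  | zero => exact ⟨0, Submodule.zero_mem _, by simp, fun n h : ℕ => by simp⟩
  | add G₁ G₂ _ _ ih₁ ih₂ =>
    obtain ⟨Z₁, h₁, h₁0, hr₁⟩ := ih₁
    obtain ⟨Z₂, h₂, h₂0, hr₂⟩ := ih₂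
    refine ⟨Z₁ + Z₂, Submodule.add_mem _ h₁ h₂, by simp [h₁0, h₂0], fun n h : ℕ => ?_⟩
    simp only [Pi.add_apply]
    rw [hr₁, hr₂]
    ring
  | smul c G _ ih =>
    obtain ⟨Z, hZ, h0, hr⟩ := ih
    refine ⟨c • Z, Submodule.smul_mem _ _ hZ, by simp [h0], fun n h : ℕ => ?_⟩
    simp only [Pi.smul_apply, smul_eq_mul]
    rw [hr]
    ring

lemma mem_of_solves {d K : ℕ} {Z G : ℕ → ℕ → ℚ} (hG : G ∈ lagSpan 1 d K)
    (h0 : ∀ h, Z 0 h = 0) (hZ : SolvesWithSource Z G) : Z ∈ lagSpan 0 (d + 1) K := by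
  obtain ⟨Z', hZ', h0', hr⟩ := exists_solution hG
  have : Z = Z' := by
    funext n
    induction n with
    | zero => funext h; rw [h0, h0']
    | succ n ih => funext h; rw [hZ, hr, ih]
  rwa [this]

/-- At height zero and after division by `n!`, only the denominators
`n (n - 1) ⋯ (n - k + 1)` with `k ≤ K` occur. -/
lemma isPolySeq {d K K' : ℕ} (hK : K ≤ K') {F : ℕ → ℕ → ℚ} (hF : F ∈ lagSpan 0 d K) :
    IsPolySeq (d + K') fun n => F n 0 / n.factorial * n.descFactorial K' := by
  induction hF using Submodule.span_induction with
  | mem F hF =>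
    obtain ⟨p, k, hk, hp, h0, rfl⟩ := hF
    refine ⟨p * (descPochhammer ℚ (K' - k)).comp (X - C (k : ℚ)), ?_, fun n => ?_⟩
    · have h1 : ((descPochhammer ℚ (K' - k)).comp (X - C (k : ℚ))).natDegree ≤ K' - k := by
        refine natDegree_comp_le.trans ?_
        rw [descPochhammer_natDegree, natDegree_X_sub_C, mul_one]
      exact (natDegree_mul_le_of_le hp h1).trans (by omega)
    · rcases lt_or_ge n k with hlt | hge
      · simp [h0 n hlt]
      · have h1 : (n : ℚ) - k = ((n - k : ℕ) : ℚ) := by rw [Nat.cast_sub hge]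
        have h2 : ((n - k).descFactorial (K' - k) : ℚ) * n.descFactorial k
            = n.descFactorial K' := by
          exact_mod_cast Nat.descFactorial_mul_descFactorial (hk.trans hK)
        have h3 : ((n - k).factorial : ℚ) * n.descFactorial k = n.factorial := by
          exact_mod_cast Nat.factorial_mul_descFactorial hge
        have h4 : (n.factorial : ℚ) ≠ 0 := by exact_mod_cast n.factorial_ne_zero
        rw [eval_mul, eval_comp, eval_sub, eval_X, eval_C, h1,
          descPochhammer_eval_eq_descFactorial]
        simp only [← h2, openCount, add_zero, Nat.descFactorial_zero, Nat.cast_one, mul_one]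
        field_simp
        rw [← h3]
        ring
  | zero => simpa using (IsPolySeq.const 0).mono (Nat.zero_le _)
  | add F G _ _ ih₁ ih₂ =>
    convert ih₁.add ih₂ using 2
    simp only [Pi.add_apply]
    ring
  | smul c F _ ih =>
    convert ih.const_mul c using 2
    simp only [Pi.smul_apply, smul_eq_mul]
    ring

end lagSpan

/-! ### Coefficients of the generating function -/

section
open Polynomial

/-- The generating function `openSum` with `1 + x` marking inversions and `1 + y` marking the
footrule, where `x` is the inner and `y` the outer variable. -/
noncomputable def openSeries (n h : ℕ) : ℕ[X][X] := openSum (C (X + 1)) (X + 1) n h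

/-- The coefficients of `openSeries`; at height zero these are the sums of the products of
binomial coefficients of `inv` and `na`. -/
noncomputable def binomSum (i j n h : ℕ) : ℕ := ((openSeries n h).coeff j).coeff i

lemma binomSum_zero (i j n : ℕ) : binomSum i j n 0
    = ∑ π : Equiv.Perm (Fin n), (permInv π).choose i * (permNa π).choose j := by
  rw [binomSum, openSeries, openSum_zero, finsetSum_coeff, finsetSum_coeff]
  refine Finset.sum_congr rfl fun π _ => ?_
  rw [← C_pow, coeff_C_mul, coeff_X_add_one_pow, coeff_mul_natCast, coeff_X_add_one_pow]
  simp

/-- The weight of a level step at height `h`. -/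
noncomputable def levelWeight (h : ℕ) : ℕ[X] :=
  (X + 1) ^ h * (∑ i ∈ Finset.range h, (X + 1) ^ i + ∑ i ∈ Finset.range (h + 1), (X + 1) ^ i)

/-- The weight of a step from height `h` down to `h - 1`. -/
noncomputable def downWeight (h : ℕ) : ℕ[X] :=
  (X + 1) ^ (2 * h - 1) * (∑ i ∈ Finset.range h, (X + 1) ^ i) ^ 2

lemma openSeries_succ (n h : ℕ) : openSeries (n + 1) h = (X + 1) ^ (2 * h) *
    (openSeries n (h + 1) + C (levelWeight h) * openSeries n h
      + C (downWeight h) * openSeries n (h - 1)) := by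
  rw [openSeries, openSum_succ]
  simp only [openSeries, levelWeight, downWeight, map_mul, map_pow, map_add, map_sum]

lemma binomSum_zero_left (i j h : ℕ) :
    binomSum i j 0 h = if i = 0 ∧ j = 0 ∧ h = 0 then 1 else 0 := by
  rw [binomSum, openSeries, openSum_zero_left]
  rcases Nat.eq_zero_or_pos h with rfl | hh
  · rcases Nat.eq_zero_or_pos j with rfl | hj
    · rcases Nat.eq_zero_or_pos i with rfl | hi
      · simp
      · simp [coeff_one, hi.ne']
    · simp [coeff_one, hj.ne']
  · simp [hh.ne']

/-- The contribution to the coefficient recurrence at height `h` of a step whose weight supplies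
the factor `x ^ a * y ^ b`, where `u`, `c` and `d` are the values at the heights `h + 1`, `h` and
`h - 1`. -/
noncomputable def stepTerm (a b h : ℕ) (u c d : ℚ) : ℚ :=
  ((2 * h).choose b : ℚ) * ((if a = 0 then 1 else 0) * u + ((levelWeight h).coeff a : ℚ) * c
    + ((downWeight h).coeff a : ℚ) * d)

lemma binomSum_succ (i j n h : ℕ) : (binomSum i j (n + 1) h : ℚ)
    = ∑ p ∈ Finset.HasAntidiagonal.antidiagonal j ×ˢ Finset.HasAntidiagonal.antidiagonal i,
        stepTerm p.2.1 p.1.1 h (binomSum p.2.2 p.1.2 n (h + 1)) (binomSum p.2.2 p.1.2 n h)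
          (binomSum p.2.2 p.1.2 n (h - 1)) := by
  have e : openSeries (n + 1) h = (X + 1) ^ (2 * h) *
    (C 1 * openSeries n (h + 1) + C (levelWeight h) * openSeries n h
      + C (downWeight h) * openSeries n (h - 1)) := by
    rw [openSeries_succ, map_one, one_mul]
  rw [binomSum, e, coeff_mul, finsetSum_coeff, Finset.sum_product, Nat.cast_sum]
  refine Finset.sum_congr rfl fun p _ => ?_
  rw [coeff_X_add_one_pow, coeff_natCast_mul]
  simp only [coeff_add, coeff_C_mul]
  rw [coeff_mul, coeff_mul, coeff_mul, ← Finset.sum_add_distrib,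
    ← Finset.sum_add_distrib, Finset.mul_sum, Nat.cast_sum]
  refine Finset.sum_congr rfl fun r _ => ?_
  simp only [coeff_one, stepTerm, binomSum]
  push_cast
  rfl

lemma coeff_geom_sum (h i : ℕ) :
    (∑ k ∈ Finset.range h, (X + 1 : ℕ[X]) ^ k).coeff i = h.choose (i + 1) := by
  induction h with
  | zero => simp
  | succ h ih =>
    rw [Finset.sum_range_succ, coeff_add, ih, coeff_X_add_one_pow, Nat.choose_succ_succ, add_comm]
    rfl

lemma coeff_levelWeight (h a : ℕ) : (levelWeight h).coeff a
    = ∑ p ∈ Finset.HasAntidiagonal.antidiagonal a,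
        h.choose p.1 * (h.choose (p.2 + 1) + (h + 1).choose (p.2 + 1)) := by
  rw [levelWeight, coeff_mul]
  refine Finset.sum_congr rfl fun p _ => ?_
  rw [coeff_X_add_one_pow, coeff_add, coeff_geom_sum, coeff_geom_sum]
  rfl

lemma coeff_downWeight (h a : ℕ) : (downWeight h).coeff a
    = ∑ p ∈ Finset.HasAntidiagonal.antidiagonal a, (2 * h - 1).choose p.1 *
        ∑ r ∈ Finset.HasAntidiagonal.antidiagonal p.2, h.choose (r.1 + 1) * h.choose (r.2 + 1) := by
  rw [downWeight, coeff_mul]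
  refine Finset.sum_congr rfl fun p _ => ?_
  rw [coeff_X_add_one_pow, pow_two, coeff_mul]
  simp only [coeff_geom_sum]
  rfl

lemma isPolySeq_levelWeight (a : ℕ) :
    IsPolySeq (a + 1) fun h => ((levelWeight h).coeff a : ℚ) := by
  simp only [coeff_levelWeight, Nat.cast_sum]
  refine IsPolySeq.sum _ fun p hp => ?_
  have hp := Finset.HasAntidiagonal.mem_antidiagonal.1 hp
  have h1 := (IsPolySeq.choose p.1).mul
    ((IsPolySeq.choose (p.2 + 1)).add ((IsPolySeq.choose (p.2 + 1)).comp_linear 1 1))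
  refine (h1.mono (e := a + 1) (by omega)).congr fun n => ?_
  push_cast
  rw [one_mul]

/-- The down weight is `h ^ 2` times a polynomial in `h`, since each factor
`1 + q + ⋯ + q ^ (h - 1)` is divisible by `h` coefficientwise. -/
lemma exists_downWeight_eq (a : ℕ) : ∃ f : ℕ → ℚ, IsPolySeq a f ∧
    ∀ h, ((downWeight h).coeff a : ℚ) = f h * (h : ℚ) ^ 2 := by
  have hg : IsPolySeq a fun h =>
      ∑ p ∈ Finset.HasAntidiagonal.antidiagonal a, ((2 * h + 1).choose p.1 : ℚ) *
      ∑ r ∈ Finset.HasAntidiagonal.antidiagonal p.2, ((r.1 + 1 : ℚ)⁻¹ * (h.choose r.1 : ℚ)) *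
        ((r.2 + 1 : ℚ)⁻¹ * (h.choose r.2 : ℚ)) := by
    refine IsPolySeq.sum _ fun p hp => ?_
    have hp := Finset.HasAntidiagonal.mem_antidiagonal.1 hp
    refine IsPolySeq.mono (d := p.1 + p.2) ?_ hp.le
    refine ((IsPolySeq.choose p.1).comp_linear 2 1).mul ?_
    refine IsPolySeq.sum _ fun r hr => ?_
    have hr := Finset.HasAntidiagonal.mem_antidiagonal.1 hr
    refine IsPolySeq.mono (d := r.1 + r.2) ?_ hr.le
    exact ((IsPolySeq.choose r.1).const_mul _).mul ((IsPolySeq.choose r.2).const_mul _)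
  obtain ⟨f, hf, hfg⟩ := hg.exists_of_succ
  refine ⟨f, hf, fun h => ?_⟩
  rw [coeff_downWeight]
  rcases h with _ | h
  · simp
  · have key : ∀ r : ℕ, ((h + 1).choose (r + 1) : ℚ) = (h + 1) * ((r + 1 : ℚ)⁻¹ * h.choose r) := by
      intro r
      have h1 : ((h + 1 : ℕ) : ℚ) * h.choose r = (h + 1).choose (r + 1) * ((r + 1 : ℕ) : ℚ) := by
        exact_mod_cast Nat.add_one_mul_choose_eq h r
      push_cast at h1
      field_simp
      linear_combination -h1
    rw [hfg, Finset.sum_mul]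
    push_cast
    refine Finset.sum_congr rfl fun p _ => ?_
    rw [show 2 * (h + 1) - 1 = 2 * h + 1 by omega, mul_assoc, Finset.sum_mul]
    congr 1
    refine Finset.sum_congr rfl fun r _ => ?_
    rw [key, key]
    ring

/-- A step supplying a factor of total order `a + b` raises the degree by `a + b`. -/
lemma stepTerm_mem {d K a b : ℕ} {F : ℕ → ℕ → ℚ} (hF : F ∈ lagSpan 0 d K) :
    (fun n h : ℕ => stepTerm a b h (F n (h + 1)) (F n h) (F n (h - 1)))
      ∈ lagSpan 1 (d + (a + b)) (K + (a + b) + 2) := by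
  have hb : IsPolySeq b fun h => ((2 * h).choose b : ℚ) := (IsPolySeq.choose b).comp_linear 2 0
  obtain ⟨f, hf, hfe⟩ := exists_downWeight_eq a
  have h1 : (fun n h : ℕ => ((2 * h).choose b : ℚ) * ((if a = 0 then 1 else 0) * F n (h + 1)))
      ∈ lagSpan 1 (d + (a + b)) (K + (a + b) + 2) := by
    have hc : IsPolySeq 0 fun _ => if a = 0 then (1 : ℚ) else 0 := IsPolySeq.const _
    have := lagSpan.polySeq_mul_mem hb (lagSpan.polySeq_mul_mem hc (lagSpan.up_mem hF))
    exact lagSpan.shift_mem (lagSpan.mono (by omega) (by omega) this)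
  have h2 : (fun n h : ℕ => ((2 * h).choose b : ℚ) * (((levelWeight h).coeff a : ℚ) * F n h))
      ∈ lagSpan 1 (d + (a + b)) (K + (a + b) + 2) := by
    have := lagSpan.polySeq_mul_mem hb (lagSpan.polySeq_mul_mem (isPolySeq_levelWeight a) hF)
    exact lagSpan.shift_mem (lagSpan.mono (by omega) (by omega) this)
  have h3 : (fun n h : ℕ => ((2 * h).choose b : ℚ) * (f h * ((h : ℚ) ^ 2 * F n (h - 1))))
      ∈ lagSpan 1 (d + (a + b)) (K + (a + b) + 2) := by
    have := lagSpan.polySeq_mul_mem hb (lagSpan.polySeq_mul_mem hf (lagSpan.down_mem hF))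
    exact lagSpan.mono (by omega) (by omega) this
  convert Submodule.add_mem _ (Submodule.add_mem _ h1 h2) h3 using 1
  ext n h
  simp only [stepTerm, hfe, Pi.add_apply]
  ring

/-- Each order adds two degrees and three shifts. The induction solves the recurrence of
`openCount` with a source built from the coefficients of lower order. -/
lemma binomSum_mem (e : ℕ) : ∀ i j, i + j = e →
    (fun n h : ℕ => (binomSum i j n h : ℚ)) ∈ lagSpan 0 (2 * e) (3 * e) := by
  induction e using Nat.strong_induction_on with
  | _ e ih =>
  intro i j hij
  -- The terms in which the step supplies no factor `x` or `y` form the recurrence of `openCount`;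
  -- all others belong to the source.
  have hmain : ((0, j), (0, i)) ∈
      Finset.HasAntidiagonal.antidiagonal j ×ˢ Finset.HasAntidiagonal.antidiagonal i := by simp
  let S := (Finset.HasAntidiagonal.antidiagonal j ×ˢ
    Finset.HasAntidiagonal.antidiagonal i).erase ((0, j), (0, i))
  let G : ℕ → ℕ → ℚ := ∑ p ∈ S, fun n h : ℕ => stepTerm p.2.1 p.1.1 h
    (binomSum p.2.2 p.1.2 n (h + 1)) (binomSum p.2.2 p.1.2 n h) (binomSum p.2.2 p.1.2 n (h - 1))
  have hsol : lagSpan.SolvesWithSource (fun n h : ℕ => (binomSum i j n h : ℚ)) G := by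
    intro n h
    simp only [G, Finset.sum_apply]
    rw [binomSum_succ, ← Finset.add_sum_erase _ _ hmain]
    congr 1
    have h1 : (levelWeight h).coeff 0 = 2 * h + 1 := by
      rw [coeff_levelWeight]; simp; ring
    have h2 : (downWeight h).coeff 0 = h ^ 2 := by
      rw [coeff_downWeight]; simp; ring
    simp only [stepTerm, h1, h2]
    push_cast
    simp
  rcases Nat.eq_zero_or_pos e with rfl | he
  · obtain ⟨rfl, rfl⟩ : i = 0 ∧ j = 0 := by omega
    have hG : G = 0 := by simp [G, S]
    have hcount : (fun n h : ℕ => (binomSum 0 0 n h : ℚ)) = openCount := by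
      funext n
      induction n with
      | zero =>
        funext h
        rw [binomSum_zero_left]
        rcases h with _ | h <;> simp [openCount]
      | succ n ihn =>
        funext h
        have h1 := hsol n h
        simp only [hG, Pi.zero_apply, add_zero] at h1
        rw [h1, openCount_succ_left, ← ihn]
    rw [hcount]
    simpa using lagSpan.generator_mem (s := 0) (d := 0) (K := 0) (p := 1) (k := 0)
      le_rfl (by simp) (by simp)
  · have hGmem : G ∈ lagSpan 1 (2 * e - 1) (3 * e) := by
      refine Submodule.sum_mem _ fun p hp => ?_
      obtain ⟨hne, hp⟩ := Finset.mem_erase.1 hp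
      obtain ⟨hp1, hp2⟩ := Finset.mem_product.1 hp
      have hp1 := Finset.HasAntidiagonal.mem_antidiagonal.1 hp1
      have hp2 := Finset.HasAntidiagonal.mem_antidiagonal.1 hp2
      have hpos : 0 < p.2.1 + p.1.1 := by
        by_contra hcon
        refine hne (Prod.ext (Prod.ext ?_ ?_) (Prod.ext ?_ ?_)) <;> simp only <;> omega
      have h1 := ih (p.2.2 + p.1.2) (by omega) p.2.2 p.1.2 rfl
      have h2 : (fun n h : ℕ => stepTerm p.2.1 p.1.1 h (binomSum p.2.2 p.1.2 n (h + 1))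
          (binomSum p.2.2 p.1.2 n h) (binomSum p.2.2 p.1.2 n (h - 1))) ∈ _ := stepTerm_mem h1
      have h3 : 2 * (p.2.2 + p.1.2) + (p.2.1 + p.1.1) ≤ 2 * e - 1 := by omega
      have h4 : 3 * (p.2.2 + p.1.2) + (p.2.1 + p.1.1) + 2 ≤ 3 * e := by omega
      exact lagSpan.mono h3 h4 h2
    have h0 : ∀ h, (binomSum i j 0 h : ℚ) = 0 := by
      intro h
      rw [binomSum_zero_left, if_neg (by omega), Nat.cast_zero]
    have := lagSpan.mem_of_solves hGmem h0 hsol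
    rwa [show 2 * e - 1 + 1 = 2 * e by omega] at this

end

/-! ### Central moments as polynomial sequences -/

/-- The sum over permutations of `(inv - μ) ^ r * (na - ν) ^ s` times binomial coefficients of
`inv` and `na`, where `μ = n (n - 1) / 4` and `ν = (n ^ 2 - 1) / 3` are the two means. -/
def centeredSum (r s k l n : ℕ) : ℚ :=
  ∑ π : Equiv.Perm (Fin n), ((permInv π : ℚ) - n * (n - 1) / 4) ^ r *
    ((permNa π : ℚ) - (n ^ 2 - 1) / 3) ^ s * (permInv π).choose k * (permNa π).choose l

lemma cast_mul_choose (x k : ℕ) : (x : ℚ) * x.choose k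
    = (k + 1) * x.choose (k + 1) + k * x.choose k := by
  have h := Nat.choose_succ_right_eq x k
  rcases le_or_gt k x with hk | hk
  · have h' : (x.choose (k + 1) : ℚ) * (k + 1) = x.choose k * (x - k) := by
      rw [← Nat.cast_sub hk]; exact_mod_cast h
    linear_combination -h'
  · simp [Nat.choose_eq_zero_of_lt hk, Nat.choose_eq_zero_of_lt (hk.trans (Nat.lt_succ_self k))]

lemma centeredSum_succ_left (r s k l n : ℕ) : centeredSum (r + 1) s k l n
    = (k + 1) * centeredSum r s (k + 1) l n
      + (k - (n : ℚ) * (n - 1) / 4) * centeredSum r s k l n := by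
  simp only [centeredSum, Finset.mul_sum, ← Finset.sum_add_distrib]
  refine Finset.sum_congr rfl fun π _ => ?_
  have h := cast_mul_choose (permInv π) k
  linear_combination ((permInv π : ℚ) - n * (n - 1) / 4) ^ r *
    ((permNa π : ℚ) - (n ^ 2 - 1) / 3) ^ s * (permNa π).choose l * h

lemma centeredSum_succ_right (r s k l n : ℕ) : centeredSum r (s + 1) k l n
    = (l + 1) * centeredSum r s k (l + 1) n
      + (l - ((n : ℚ) ^ 2 - 1) / 3) * centeredSum r s k l n := by
  simp only [centeredSum, Finset.mul_sum, ← Finset.sum_add_distrib]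
  refine Finset.sum_congr rfl fun π _ => ?_
  have h := cast_mul_choose (permNa π) l
  linear_combination ((permInv π : ℚ) - n * (n - 1) / 4) ^ r *
    ((permNa π : ℚ) - (n ^ 2 - 1) / 3) ^ s * (permInv π).choose k * h

/-- Up to the denominator `n (n - 1) ⋯ (n - 3 E + 1)`, the centered moments of total order at
most `E` are polynomials of degree at most `2 E + 3 E`. -/
lemma isPolySeq_centeredSum {E : ℕ} (r s k l : ℕ) (h : r + s + k + l ≤ E) :
    IsPolySeq (2 * (r + s + k + l) + 3 * E)
      fun n => centeredSum r s k l n / n.factorial * n.descFactorial (3 * E) := by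
  induction r generalizing k with
  | succ r ih =>
    have hμ : IsPolySeq 2 fun n => (k : ℚ) - (n : ℚ) * (n - 1) / 4 :=
      ((((IsPolySeq.natCast.mul IsPolySeq.natCast).const_mul (-1 / 4)).add
        ((IsPolySeq.natCast.const_mul (1 / 4)).mono one_le_two)).add
          ((IsPolySeq.const (k : ℚ)).mono (Nat.zero_le 2))).congr fun n => by ring
    refine ((((ih (k + 1) (by omega)).const_mul (k + 1)).mono
      (e := 2 * (r + 1 + s + k + l) + 3 * E) (by omega)).add
      ((hμ.mul (ih k (by omega))).mono (by omega))).congr fun n => ?_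
    rw [centeredSum_succ_left]
    ring
  | zero =>
    induction s generalizing l with
    | succ s ih =>
      have hν : IsPolySeq 2 fun n => (l : ℚ) - ((n : ℚ) ^ 2 - 1) / 3 :=
        (((IsPolySeq.natCast.mul IsPolySeq.natCast).const_mul (-1 / 3)).add
          ((IsPolySeq.const (l + 1 / 3 : ℚ)).mono (Nat.zero_le 2))).congr fun n => by ring
      refine ((((ih (l + 1) (by omega)).const_mul (l + 1)).mono
        (e := 2 * (0 + (s + 1) + k + l) + 3 * E) (by omega)).add
        ((hν.mul (ih l (by omega))).mono (by omega))).congr fun n => ?_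
      rw [centeredSum_succ_right]
      ring
    | zero =>
      have h1 := lagSpan.isPolySeq (K' := 3 * E) (by omega) (binomSum_mem (k + l) k l rfl)
      refine (h1.mono (by omega)).congr fun n => ?_
      rw [binomSum_zero, centeredSum]
      push_cast
      simp

lemma IsPolySeq.eq_of_agree {d : ℕ} {f g : ℕ → ℚ} (hf : IsPolySeq d f) (hg : IsPolySeq d g)
    (h : ∀ n ≤ d, f n = g n) : f = g := by
  obtain ⟨p, hp, hpf⟩ := hf
  obtain ⟨r, hr, hrg⟩ := hg
  have h0 : p - r = 0 := by
    refine Polynomial.eq_zero_of_natDegree_lt_card_of_eval_eq_zero' (p - r)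
      ((Finset.range (d + 1)).image fun n : ℕ => (n : ℚ)) ?_ ?_
    · intro x hx
      obtain ⟨n, hn, rfl⟩ := Finset.mem_image.1 hx
      rw [Polynomial.eval_sub, ← hpf, ← hrg, h n (by have := Finset.mem_range.1 hn; omega),
        sub_self]
    · rw [Finset.card_image_of_injective _ Nat.cast_injective, Finset.card_range]
      exact Nat.lt_succ_of_le (Polynomial.natDegree_sub_le_of_le hp hr |>.trans (by simp))
  funext n
  rw [hpf, hrg, sub_eq_zero.1 h0]

/-! ### Tables of coefficients and moments -/

/-- Coefficientwise sum of coefficient lists. -/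
def addList : List ℕ → List ℕ → List ℕ
  | [], b => b
  | x :: a, b =>
    match b with
    | [] => x :: a
    | y :: b => (x + y) :: addList a b

/-- Product of coefficient lists, correct below degree `L`. -/
def mulList : ℕ → List ℕ → List ℕ → List ℕ
  | 0, _, _ => []
  | _ + 1, [], _ => []
  | L + 1, x :: a, b => addList ((b.take (L + 1)).map (x * ·)) (0 :: mulList L a b)

/-- Coefficientwise sum of two-variable coefficient tables. The outer index of a table is the
exponent of `y`, the inner one that of `x`. -/
def addTable : List (List ℕ) → List (List ℕ) → List (List ℕ)
  | [], b => b
  | x :: a, b =>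
    match b with
    | [] => x :: a
    | y :: b => addList x y :: addTable a b

/-- Product of a table by a list in the variable `x`, correct below total degree `L`. -/
def mulInner : ℕ → List ℕ → List (List ℕ) → List (List ℕ)
  | _, _, [] => []
  | L, a, r :: S => mulList L a r :: mulInner (L - 1) a S

/-- Product of a table by a list in the variable `y`, correct below total degree `L`. -/
def mulOuter : ℕ → List ℕ → List (List ℕ) → List (List ℕ)
  | 0, _, _ => []
  | _ + 1, [], _ => []
  | L + 1, x :: a, S =>
    addTable ((S.take (L + 1)).map fun r => (r.take (L + 1)).map (x * ·)) ([] :: mulOuter L a S)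

/-- The coefficients of `(1 + x) ^ m` from degree `e` on, below degree `e + 9`. For `e = 1` these
are the coefficients of `1 + q + ⋯ + q ^ (m - 1)` with `q = 1 + x`. -/
def chooseList (e m : ℕ) : List ℕ :=
  (List.range 9).map fun k => m.descFactorial (k + e) / (k + e).factorial

/-- The coefficients of `levelWeight h`. -/
def levelList (h : ℕ) : List ℕ :=
  mulList 9 (chooseList 0 h) (addList (chooseList 1 h) (chooseList 1 (h + 1)))

/-- The coefficients of `downWeight h`. -/
def downList (h : ℕ) : List ℕ :=
  mulList 9 (chooseList 0 (2 * h - 1)) (mulList 9 (chooseList 1 h) (chooseList 1 h))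

/-- One step of the recurrence `openSeries_succ` on coefficient tables; `u`, `c` and `d` are the
tables at the heights `h + 1`, `h` and `h - 1`. -/
def stepTable (h : ℕ) (u c d : List (List ℕ)) : List (List ℕ) :=
  mulOuter 9 (chooseList 0 (2 * h))
    (addTable u (addTable (mulInner 9 (levelList h) c) (mulInner 9 (downList h) d)))

/-- The tables of `openSeries (n + 1) h` for all `h` with `n + 1 + h ≤ N`, from those of
`openSeries n h`. -/
def nextTables (N n : ℕ) (row : List (List (List ℕ))) : List (List (List ℕ)) :=
  (List.range (min (n + 2) (N - n))).map fun h =>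
    stepTable h (row.getD (h + 1) []) (row.getD h []) (row.getD (h - 1) [])

/-- Passage from the first `L` binomial moments `∑ C(X, k) w` to the power moments
`∑ (a X - m) ^ r w`. -/
def powerMoments (a m : ℤ) : ℕ → List ℤ → List ℤ
  | 0, _ => []
  | L + 1, xs => xs.getD 0 0 :: powerMoments a m L ((List.range L).map fun k : ℕ =>
      a * (k + 1) * xs.getD (k + 1) 0 + (a * k - m) * xs.getD k 0)

/-- The moments of `4 inv - n (n - 1)`, weighted by binomial coefficients of `na`. -/
def innerMoments (n : ℕ) (S : List (List ℕ)) : List (List ℤ) :=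
  (List.range 9).map fun j =>
    powerMoments 4 ((n : ℤ) * (n - 1)) (9 - j) ((S.getD j []).map fun x : ℕ => (x : ℤ))

/-- The mixed moments of `4 inv - n (n - 1)` and `3 na - (n ^ 2 - 1)`; the outer index is the
exponent of the former. -/
def momentTable (n : ℕ) (S : List (List ℕ)) : List (List ℤ) :=
  let M := innerMoments n S
  (List.range 9).map fun r => powerMoments 3 ((n : ℤ) ^ 2 - 1) (9 - r)
    ((List.range (9 - r)).map fun j => (M.getD j []).getD r 0)

/-- Comparison of the moments obtained from a table with the explicit formulas. -/
def formulasHold (n : ℕ) (S : List (List ℕ)) : Bool :=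
  let M := momentTable n S
  (List.range 9).all fun r => (List.range (9 - r)).all fun s =>
    (s != 0 && decide (n < r + s)) ||
      decide ((((M.getD r []).getD s 0 : ℤ) : ℚ)
        = 4 ^ r * 3 ^ s * n.factorial * mixedMomentFormula r s n)

/-- The comparison for `f` consecutive values of `n`, where `row` holds the tables for the first
of them. -/
def formulasHoldFrom (N : ℕ) : ℕ → ℕ → List (List (List ℕ)) → Bool
  | 0, _, _ => true
  | f + 1, n, row =>
    formulasHold n (row.getD 0 []) && formulasHoldFrom N f (n + 1) (nextTables N n row)

/-! ### Correctness of the tables -/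

lemma getD_map_range {α : Type*} (f : ℕ → α) (d : α) (L i : ℕ) :
    ((List.range L).map f).getD i d = if i < L then f i else d := by
  split_ifs with h
  · simp [List.getD_eq_getElem?_getD, h]
  · simp [List.getD_eq_getElem?_getD, h]

lemma getD_addList (a b : List ℕ) (i : ℕ) :
    (addList a b).getD i 0 = a.getD i 0 + b.getD i 0 := by
  induction a generalizing b i with
  | nil => simp [addList]
  | cons x a ih =>
    cases b with
    | nil => simp [addList]
    | cons y b =>
      cases i with
      | zero => simp [addList]
      | succ i => simpa [addList] using ih b i

lemma getD_map_take (x : ℕ) (b : List ℕ) {L i : ℕ} (hi : i < L) :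
    ((b.take L).map (x * ·)).getD i 0 = x * b.getD i 0 := by
  simp only [List.getD_eq_getElem?_getD, List.getElem?_map, List.getElem?_take, if_pos hi]
  cases b[i]? <;> simp

lemma getD_mulList (L : ℕ) (a b : List ℕ) {i : ℕ} (hi : i < L) :
    (mulList L a b).getD i 0
      = ∑ p ∈ Finset.HasAntidiagonal.antidiagonal i, a.getD p.1 0 * b.getD p.2 0 := by
  induction L generalizing a i with
  | zero => omega
  | succ L ih =>
    cases a with
    | nil => simp [mulList]
    | cons x a =>
      rw [mulList, getD_addList, getD_map_take x b hi]
      cases i with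
      | zero => simp
      | succ i =>
        rw [Finset.Nat.sum_antidiagonal_succ, List.getD_cons_succ, ih a (by omega)]
        simp

/-- The entry of a table at exponents `i` of `x` and `j` of `y`. -/
def entryAt (S : List (List ℕ)) (i j : ℕ) : ℕ := (S.getD j []).getD i 0

lemma entryAt_addTable (S T : List (List ℕ)) (i j : ℕ) :
    entryAt (addTable S T) i j = entryAt S i j + entryAt T i j := by
  induction S generalizing T j with
  | nil => simp [addTable, entryAt]
  | cons x S ih =>
    cases T with
    | nil => simp [addTable, entryAt]
    | cons y T =>
      cases j with
      | zero => simpa [addTable, entryAt] using getD_addList x y i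
      | succ j => simpa [addTable, entryAt] using ih T j

lemma entryAt_mulInner (L : ℕ) (a : List ℕ) (S : List (List ℕ)) {i j : ℕ} (h : i + j < L) :
    entryAt (mulInner L a S) i j
      = ∑ p ∈ Finset.HasAntidiagonal.antidiagonal i, a.getD p.1 0 * entryAt S p.2 j := by
  induction S generalizing L j with
  | nil => simp [mulInner, entryAt]
  | cons r S ih =>
    cases j with
    | zero => simpa [mulInner, entryAt] using getD_mulList L a r (by omega)
    | succ j => simpa [mulInner, entryAt] using ih (L - 1) (j := j) (by omega)

lemma entryAt_map_take (x : ℕ) (S : List (List ℕ)) {L i j : ℕ} (h : i + j < L) :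
    entryAt ((S.take L).map fun r => (r.take L).map (x * ·)) i j = x * entryAt S i j := by
  have e : ((S.take L).map fun r => (r.take L).map (x * ·)).getD j []
      = ((S.getD j []).take L).map (x * ·) := by
    simp only [List.getD_eq_getElem?_getD, List.getElem?_map, List.getElem?_take,
      if_pos (show j < L by omega)]
    cases S[j]? <;> simp
  rw [entryAt, e, getD_map_take x _ (by omega), entryAt]

lemma entryAt_mulOuter (L : ℕ) (a : List ℕ) (S : List (List ℕ)) {i j : ℕ} (h : i + j < L) :
    entryAt (mulOuter L a S) i j
      = ∑ p ∈ Finset.HasAntidiagonal.antidiagonal j, a.getD p.1 0 * entryAt S i p.2 := by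
  induction L generalizing a j with
  | zero => omega
  | succ L ih =>
    cases a with
    | nil => simp [mulOuter, entryAt]
    | cons x a =>
      rw [mulOuter, entryAt_addTable, entryAt_map_take x S h]
      cases j with
      | zero => simp [entryAt]
      | succ j =>
        rw [Finset.Nat.sum_antidiagonal_succ]
        have := ih a (j := j) (by omega)
        simpa [entryAt] using this

lemma getD_chooseList (e m : ℕ) {k : ℕ} (hk : k < 9) :
    (chooseList e m).getD k 0 = m.choose (k + e) := by
  rw [chooseList, getD_map_range, if_pos hk, Nat.choose_eq_descFactorial_div_factorial]

lemma getD_levelList (h : ℕ) {i : ℕ} (hi : i < 9) :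
    (levelList h).getD i 0 = (levelWeight h).coeff i := by
  rw [levelList, getD_mulList 9 _ _ hi, coeff_levelWeight]
  refine Finset.sum_congr rfl fun p hp => ?_
  have := Finset.HasAntidiagonal.mem_antidiagonal.1 hp
  rw [getD_addList, getD_chooseList _ _ (by omega), getD_chooseList _ _ (by omega),
    getD_chooseList _ _ (by omega), add_zero]

lemma getD_downList (h : ℕ) {i : ℕ} (hi : i < 9) :
    (downList h).getD i 0 = (downWeight h).coeff i := by
  rw [downList, getD_mulList 9 _ _ hi, coeff_downWeight]
  refine Finset.sum_congr rfl fun p hp => ?_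
  have := Finset.HasAntidiagonal.mem_antidiagonal.1 hp
  rw [getD_chooseList _ _ (by omega), getD_mulList 9 _ _ (by omega), add_zero]
  congr 1
  refine Finset.sum_congr rfl fun r hr => ?_
  have := Finset.HasAntidiagonal.mem_antidiagonal.1 hr
  rw [getD_chooseList _ _ (by omega), getD_chooseList _ _ (by omega)]

/-- The table `S` holds the coefficients of `openSeries n h` of total order at most `8`. -/
def Tabulates (S : List (List ℕ)) (n h : ℕ) : Prop :=
  ∀ i j, i + j < 9 → entryAt S i j = binomSum i j n h

lemma tabulates_stepTable {n h : ℕ} {u c d : List (List ℕ)} (hu : Tabulates u n (h + 1))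
    (hc : Tabulates c n h) (hd : Tabulates d n (h - 1)) :
    Tabulates (stepTable h u c d) (n + 1) h := by
  intro i j hij
  have e : (binomSum i j (n + 1) h : ℚ) = (entryAt (stepTable h u c d) i j : ℚ) := by
    rw [binomSum_succ, Finset.sum_product, stepTable, entryAt_mulOuter 9 _ _ hij, Nat.cast_sum]
    refine Finset.sum_congr rfl fun p hp => ?_
    have hp := Finset.HasAntidiagonal.mem_antidiagonal.1 hp
    rw [entryAt_addTable, entryAt_addTable, entryAt_mulInner 9 _ _ (by omega),
      entryAt_mulInner 9 _ _ (by omega), getD_chooseList _ _ (by omega), hu i p.2 (by omega)]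
    simp only [stepTerm, ← Finset.mul_sum, Finset.sum_add_distrib]
    push_cast
    rw [add_zero, add_assoc]
    congr 2
    · rw [Finset.sum_eq_single (0, i)]
      · simp
      · intro r hr hne
        have hr := Finset.HasAntidiagonal.mem_antidiagonal.1 hr
        have : r.1 ≠ 0 := fun h0 => hne (Prod.ext h0 (by simp only; omega))
        simp [this]
      · simp
    · congr 1 <;> refine Finset.sum_congr rfl fun r hr => ?_ <;>
        have hr := Finset.HasAntidiagonal.mem_antidiagonal.1 hr
      · rw [getD_levelList _ (by omega), hc r.2 p.2 (by omega)]
      · rw [getD_downList _ (by omega), hd r.2 p.2 (by omega)]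
  exact_mod_cast e.symm

/-- At most `n` rows can still be open when `n` indices remain. -/
lemma binomSum_eq_zero (i j : ℕ) {n h : ℕ} (hn : n < h) : binomSum i j n h = 0 := by
  have : openSeries n h = 0 := by
    rw [openSeries, openSum, cornerSum]
    refine Finset.sum_eq_zero fun σ _ => if_neg fun hσ => ?_
    have hinj : Function.Injective (fun i : Fin h =>
        (⟨σ ⟨i, by omega⟩ - h, by
          have := (σ ⟨i, by omega⟩).isLt
          have := hσ ⟨i, by omega⟩ i.isLt
          omega⟩ : Fin n)) := by
      intro i i' hii
      have h1 := hσ ⟨i, by omega⟩ i.isLt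
      have h2 := hσ ⟨i', by omega⟩ i'.isLt
      have h3 := Fin.mk.inj hii
      have h4 : σ ⟨i, by omega⟩ = σ ⟨i', by omega⟩ := Fin.ext (by omega)
      have h5 := Fin.mk.inj (σ.injective h4)
      exact Fin.ext h5
    have := Fintype.card_le_of_injective _ hinj
    simp at this
    omega
  rw [binomSum, this]
  simp

lemma tabulates_nextTables {N n : ℕ} {row : List (List (List ℕ))}
    (hrow : ∀ h, n + h ≤ N → Tabulates (row.getD h []) n h) (h : ℕ) (hN : n + 1 + h ≤ N) :
    Tabulates ((nextTables N n row).getD h []) (n + 1) h := by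
  rw [nextTables, getD_map_range]
  split_ifs with hlt
  · exact tabulates_stepTable (hrow _ (by omega)) (hrow _ (by omega)) (hrow _ (by omega))
  · intro i j _
    rw [binomSum_eq_zero i j (by omega)]
    simp [entryAt]

lemma getD_powerMoments {ι : Type*} [Fintype ι] (a m : ℤ) (X : ι → ℕ) (L : ℕ) (w : ι → ℤ)
    (xs : List ℤ) (hxs : ∀ k < L, xs.getD k 0 = ∑ π, ((X π).choose k : ℤ) * w π) {r : ℕ}
    (hr : r < L) : (powerMoments a m L xs).getD r 0 = ∑ π, (a * X π - m) ^ r * w π := by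
  induction L generalizing w xs r with
  | zero => omega
  | succ L ih =>
    cases r with
    | zero => simpa [powerMoments] using hxs 0 (by omega)
    | succ r =>
      rw [powerMoments, List.getD_cons_succ, ih (fun π => (a * X π - m) * w π) _ _ (by omega)]
      · refine Finset.sum_congr rfl fun π _ => ?_
        ring
      · intro k hk
        rw [getD_map_range, if_pos hk, hxs _ (by omega), hxs _ (by omega), Finset.mul_sum,
          Finset.mul_sum, ← Finset.sum_add_distrib]
        refine Finset.sum_congr rfl fun π _ => ?_
        have h : (X π : ℤ) * (X π).choose k
            = (k + 1) * (X π).choose (k + 1) + k * (X π).choose k := by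
          exact_mod_cast cast_mul_choose (X π) k
        linear_combination -(a * w π) * h

lemma getD_momentTable {n : ℕ} {S : List (List ℕ)} (hS : Tabulates S n 0) {r s : ℕ}
    (hrs : r + s < 9) : (((momentTable n S).getD r []).getD s 0 : ℚ)
      = 4 ^ r * 3 ^ s * centeredSum r s 0 0 n := by
  have h1 : ∀ j < 9 - r, ((innerMoments n S).getD j []).getD r 0
      = ∑ π : Equiv.Perm (Fin n), ((permNa π).choose j : ℤ) *
        (4 * permInv π - (n : ℤ) * (n - 1)) ^ r := by
    intro j hj
    rw [innerMoments, getD_map_range, if_pos (by omega),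
      getD_powerMoments 4 _ (fun π : Equiv.Perm (Fin n) => permInv π) (9 - j)
        (fun π => ((permNa π).choose j : ℤ)) _ _ (by omega)]
    · exact Finset.sum_congr rfl fun π _ => mul_comm _ _
    · intro k hk
      have h2 := hS k j (by omega)
      rw [binomSum_zero, entryAt] at h2
      have h3 : ((S.getD j []).map fun x : ℕ => (x : ℤ)).getD k 0
          = (((S.getD j []).getD k 0 : ℕ) : ℤ) := by
        simp only [List.getD_eq_getElem?_getD, List.getElem?_map]
        cases (S[j]?.getD [])[k]? <;> simp
      rw [h3, h2]
      push_cast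
      rfl
  rw [momentTable, getD_map_range, if_pos (by omega),
    getD_powerMoments 3 _ (fun π : Equiv.Perm (Fin n) => permNa π) (9 - r)
      (fun π => (4 * permInv π - (n : ℤ) * (n - 1)) ^ r) _ _ (by omega)]
  · rw [centeredSum, Finset.mul_sum]
    push_cast
    refine Finset.sum_congr rfl fun π _ => ?_
    rw [show (3 * (permNa π : ℚ) - ((n : ℚ) ^ 2 - 1)) = 3 * (permNa π - ((n : ℚ) ^ 2 - 1) / 3) by
        ring, show (4 * (permInv π : ℚ) - n * (n - 1)) = 4 * (permInv π - n * (n - 1) / 4) by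
        ring, mul_pow, mul_pow]
    simp
    ring
  · intro j hj
    rw [getD_map_range, if_pos hj, h1 j hj]

/-- The comparison succeeds only if the formulas hold; it skips `n < r + s` with `s ≠ 0`. -/
lemma centeredSum_of_formulasHold {n : ℕ} {S : List (List ℕ)} (hS : Tabulates S n 0)
    (h : formulasHold n S = true) {r s : ℕ} (hrs : r + s ≤ 8) (hn : s = 0 ∨ r + s ≤ n) :
    centeredSum r s 0 0 n = n.factorial * mixedMomentFormula r s n := by
  rw [formulasHold, List.all_eq_true] at h
  have h1 := h r (List.mem_range.2 (by omega))
  rw [List.all_eq_true] at h1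
  have h2 := h1 s (List.mem_range.2 (by omega))
  rw [Bool.or_eq_true, Bool.and_eq_true, bne_iff_ne, decide_eq_true_eq, decide_eq_true_eq] at h2
  rcases h2 with h2 | h2
  · omega
  · rw [getD_momentTable hS (by omega)] at h2
    have h3 : (4 ^ r * 3 ^ s : ℚ) ≠ 0 := by positivity
    refine mul_left_cancel₀ h3 ?_
    rw [h2]
    ring

lemma formulasHold_of_formulasHoldFrom {N f n : ℕ} {row : List (List (List ℕ))}
    (hrow : ∀ h, n + h ≤ N → Tabulates (row.getD h []) n h)
    (h : formulasHoldFrom N f n row = true) {m : ℕ} (hnm : n ≤ m) (hmf : m < n + f)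
    (hmN : m ≤ N) : ∃ S, Tabulates S m 0 ∧ formulasHold m S = true := by
  induction f generalizing n row with
  | zero => omega
  | succ f ih =>
    rw [formulasHoldFrom, Bool.and_eq_true] at h
    rcases hnm.eq_or_lt with rfl | hlt
    · exact ⟨_, hrow 0 (by omega), h.1⟩
    · exact ih (fun k hk => tabulates_nextTables hrow k hk) h.2 (by omega) (by omega)

/-- The tables are computed and compared by kernel evaluation. -/
lemma formulasHoldFrom_forty : formulasHoldFrom 40 41 0 [[[1]]] = true := by
  decide +kernel

lemma centeredSum_eq_of_le_forty {r s n : ℕ} (hrs : r + s ≤ 8) (hn : s = 0 ∨ r + s ≤ n)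
    (h40 : n ≤ 40) : centeredSum r s 0 0 n = n.factorial * mixedMomentFormula r s n := by
  have h0 : ∀ h, 0 + h ≤ 40 → Tabulates ([[[1]]].getD h []) 0 h := by
    intro h _ i j _
    rw [binomSum_zero_left]
    rcases h with _ | h
    · rcases j with _ | j
      · rcases i with _ | i <;> simp [entryAt]
      · simp [entryAt]
    · simp [entryAt]
  obtain ⟨S, hS, hf⟩ := formulasHold_of_formulasHoldFrom h0 formulasHoldFrom_forty
    (Nat.zero_le n) (by omega) h40
  exact centeredSum_of_formulasHold hS hf hrs hn

/-! ### Leading coefficients of the explicit formulas -/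

/-- `f` is a polynomial function of degree at most `d` whose coefficient of degree `d` is `c`. -/
def HasLead (d : ℕ) (c : ℚ) (f : ℚ → ℚ) : Prop :=
  ∃ p : Polynomial ℚ, p.natDegree ≤ d ∧ p.coeff d = c ∧ ∀ x, f x = p.eval x

namespace HasLead
open Polynomial

lemma const (d : ℕ) (a : ℚ) : HasLead d (if d = 0 then a else 0) fun _ => a :=
  ⟨C a, by simp, by rw [coeff_C], by simp⟩

lemma monomial {d k : ℕ} (h : k ≤ d) (a : ℚ) :
    HasLead d (if d = k then a else 0) fun x => a * x ^ k :=
  ⟨C a * X ^ k, (natDegree_C_mul_X_pow_le a k).trans h, by rw [coeff_C_mul_X_pow], by simp⟩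

lemma linear {d : ℕ} (h : 1 ≤ d) (a : ℚ) : HasLead d (if d = 1 then a else 0) fun x => a * x := by
  simpa using monomial h a

lemma pow {d k : ℕ} (h : k ≤ d) : HasLead d (if d = k then 1 else 0) fun x => x ^ k := by
  simpa using monomial h 1

lemma id {d : ℕ} (h : 1 ≤ d) : HasLead d (if d = 1 then 1 else 0) fun x => x := by
  simpa using pow h

lemma add {d : ℕ} {c e : ℚ} {f g : ℚ → ℚ} (hf : HasLead d c f) (hg : HasLead d e g) :
    HasLead d (c + e) fun x => f x + g x := by
  obtain ⟨p, hp, rfl, hpf⟩ := hf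
  obtain ⟨r, hr, rfl, hrg⟩ := hg
  exact ⟨p + r, natDegree_add_le_of_degree_le hp hr, coeff_add _ _ _, by simp [hpf, hrg]⟩

lemma sub {d : ℕ} {c e : ℚ} {f g : ℚ → ℚ} (hf : HasLead d c f) (hg : HasLead d e g) :
    HasLead d (c - e) fun x => f x - g x := by
  obtain ⟨p, hp, rfl, hpf⟩ := hf
  obtain ⟨r, hr, rfl, hrg⟩ := hg
  exact ⟨p - r, (natDegree_sub_le_of_le hp hr).trans (by simp), coeff_sub _ _ _,
    by simp [hpf, hrg]⟩

lemma congr {d : ℕ} {c e : ℚ} {f g : ℚ → ℚ} (hf : HasLead d c f) (hc : e = c)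
    (h : ∀ x, g x = f x) : HasLead d e g := by
  rw [hc, funext h]; exact hf

lemma const_mul {d : ℕ} {c : ℚ} {f : ℚ → ℚ} (a : ℚ) (hf : HasLead d c f) :
    HasLead d (a * c) fun x => a * f x := by
  obtain ⟨p, hp, rfl, hpf⟩ := hf
  exact ⟨C a * p, (natDegree_C_mul_le a p).trans hp, coeff_C_mul p, by simp [hpf]⟩

lemma add_const_mul {d : ℕ} {c : ℚ} {f : ℚ → ℚ} (hf : HasLead d c f) (a : ℚ) :
    HasLead (d + 1) c fun x => (x + a) * f x := by
  obtain ⟨p, hp, rfl, hpf⟩ := hf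
  refine ⟨(X + C a) * p, ?_, ?_, by simp [hpf]⟩
  · exact (natDegree_mul_le_of_le (natDegree_X_add_C a).le hp).trans (by omega)
  · rw [add_mul, coeff_add, coeff_X_mul, coeff_C_mul,
      coeff_eq_zero_of_natDegree_lt (Nat.lt_succ_of_le hp), mul_zero, add_zero]

lemma mul_sub_one_mul {d : ℕ} {c D : ℚ} {f : ℚ → ℚ} (hf : HasLead d c f) :
    HasLead (d + 2) (c / D) fun x => x * (x - 1) * f x / D :=
  (((hf.add_const_mul (-1)).add_const_mul 0).const_mul D⁻¹).congr (by ring) (fun x => by ring)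

lemma add_one_mul {d : ℕ} {c D : ℚ} {f : ℚ → ℚ} (hf : HasLead d c f) :
    HasLead (d + 1) (c / D) fun x => (x + 1) * f x / D :=
  ((hf.add_const_mul 1).const_mul D⁻¹).congr (by ring) (fun x => by ring)

lemma const_mul_add_one_mul {d : ℕ} {c D : ℚ} {f : ℚ → ℚ} (a : ℚ) (hf : HasLead d c f) :
    HasLead (d + 2) (-a * c / D) fun x => -a * (x + 1) * (x + 2) * f x / D :=
  (((hf.add_const_mul 2).add_const_mul 1).const_mul (-a / D)).congr (by ring) (fun x => by ring)

lemma neg_add_one_mul {d : ℕ} {c D : ℚ} {f : ℚ → ℚ} (hf : HasLead d c f) :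
    HasLead (d + 2) (-c / D) fun x => -(x + 1) * (x + 2) * f x / D :=
  (hf.const_mul_add_one_mul (D := D) 1).congr (by ring) (fun x => by ring)

end HasLead

/-- The moments `0, 1, 3, 15, …` of the standard normal distribution, interleaved with zeros. -/
def normalMoment : ℕ → ℚ
  | 0 => 1
  | 1 => 0
  | j + 2 => (j + 1) * normalMoment j

/-- The moment `E[U ^ r (3 U + V) ^ s]` of independent standard normal variables. -/
def mixedNormalMoment (r s : ℕ) : ℚ :=
  ∑ k ∈ Finset.range (s + 1),
    (s.choose k : ℚ) * 3 ^ (s - k) * normalMoment (r + s - k) * normalMoment k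

/-- Degree and coefficient of order `3 (r + s) / 2` of the explicit polynomials. -/
lemma exists_hasLead_mixedMomentFormula {r s : ℕ} (h : r + s ≤ 8) :
    ∃ c, HasLead (3 * (r + s) / 2) c (fun x => mixedMomentFormula r s x) ∧
      (Even (r + s) → c = mixedNormalMoment r s / (6 ^ r * 15 ^ s)) := by
  have hr : r ≤ 8 := by omega
  have hs : s ≤ 8 := by omega
  interval_cases r <;> interval_cases s <;> first
    | omega
    | (apply Exists.intro
       apply And.intro
       · -- The coefficient is a metavariable, assigned by unification with the rules below.
         simp only [mixedMomentFormula, Nat.reduceAdd, Nat.reduceMul, Nat.reduceDiv]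
         simp only [momentFormula0, momentFormula1, momentFormula2, momentFormula3,
           momentFormula4, momentFormula5, momentFormula6, momentFormula7, momentFormula8]
         repeat' first
           | exact HasLead.const _ _
           | apply HasLead.mul_sub_one_mul
           | apply HasLead.add_one_mul
           | apply HasLead.neg_add_one_mul
           | apply HasLead.const_mul_add_one_mul
           | apply HasLead.add
           | apply HasLead.sub
           | exact HasLead.monomial (by norm_num) _
           | exact HasLead.linear (by norm_num) _
           | exact HasLead.pow (by norm_num)
           | exact HasLead.id (by norm_num)
       · decide +kernel)

/-! ### Explicit moments and their limits -/

lemma isPolySeq_descFactorial (K : ℕ) : IsPolySeq K fun n => (n.descFactorial K : ℚ) :=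
  ⟨descPochhammer ℚ K, (descPochhammer_natDegree ℚ K).le, fun n => by
    rw [descPochhammer_eval_eq_descFactorial]⟩

/-- After multiplication by the common denominator `n (n - 1) ⋯ (n - 23)` both sides are polynomials
of degree at most `40`, and they agree for `n ≤ 40`, being zero for `n ≤ 23`. -/
lemma centeredSum_eq {r s n : ℕ} (hrs : r + s ≤ 8) (hn : s = 0 ∨ r + s ≤ n) :
    centeredSum r s 0 0 n = n.factorial * mixedMomentFormula r s n := by
  rcases le_or_gt n 40 with h40 | h40
  · exact centeredSum_eq_of_le_forty hrs hn h40
  · -- The denominator is kept opaque, so that unification does not unfold it.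
    obtain ⟨K, hK⟩ : ∃ K, K = 3 * 8 := ⟨_, rfl⟩
    have hf := isPolySeq_centeredSum (E := 8) r s 0 0 (by omega)
    rw [← hK] at hf
    replace hf := hf.mono (show 2 * (r + s + 0 + 0) + K ≤ 40 by omega)
    obtain ⟨c, ⟨p, hp, -, hpf⟩, -⟩ := exists_hasLead_mixedMomentFormula hrs
    have hP : IsPolySeq (3 * (r + s) / 2) fun n => mixedMomentFormula r s n :=
      ⟨p, hp, fun n => hpf n⟩
    have hg := (hP.mul (isPolySeq_descFactorial K)).mono
      (show 3 * (r + s) / 2 + K ≤ 40 by omega)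
    have key := hf.eq_of_agree hg fun m hm => by
      rcases lt_or_ge m K with hlt | hge
      · simp [Nat.descFactorial_of_lt hlt]
      · have h0 : (m.factorial : ℚ) ≠ 0 := by exact_mod_cast m.factorial_ne_zero
        rw [centeredSum_eq_of_le_forty hrs (by omega) hm, mul_div_cancel_left₀ _ h0]
    have h1 := congrFun key n
    have h2 : (n.descFactorial K : ℚ) ≠ 0 := by
      have : n.descFactorial K ≠ 0 := by
        rw [Ne, Nat.descFactorial_eq_zero_iff_lt]; omega
      exact_mod_cast this
    have h3 : (n.factorial : ℚ) ≠ 0 := by exact_mod_cast n.factorial_ne_zero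
    rw [(div_eq_iff h3).1 (mul_right_cancel₀ h2 h1), mul_comm]

lemma card_perm_fin_cast (n : ℕ) :
    (Fintype.card (Equiv.Perm (Fin n)) : ℚ) = n.factorial := by
  rw [Fintype.card_perm, Fintype.card_fin]

lemma permExp_permInv (n : ℕ) :
    permExp n (fun τ => (permInv τ : ℚ)) = (n : ℚ) * (n - 1) / 4 := by
  have h := centeredSum_eq (r := 1) (s := 0) (n := n) (by norm_num) (Or.inl rfl)
  have h0 : (n.factorial : ℚ) ≠ 0 := by exact_mod_cast n.factorial_ne_zero
  simp only [centeredSum, mixedMomentFormula, momentFormula1, Nat.choose_zero_right, pow_one,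
    pow_zero, Nat.cast_one, mul_one, mul_zero, Finset.sum_sub_distrib, Finset.sum_const,
    Finset.card_univ, nsmul_eq_mul, card_perm_fin_cast, add_zero] at h
  rw [permExp, card_perm_fin_cast, sub_eq_zero.1 h, mul_div_cancel_left₀ _ h0]

lemma permExp_permNa {n : ℕ} (hn : 1 ≤ n) :
    permExp n (fun τ => (permNa τ : ℚ)) = ((n : ℚ) ^ 2 - 1) / 3 := by
  have h := centeredSum_eq (r := 0) (s := 1) (n := n) (by norm_num) (Or.inr (by omega))
  have h0 : (n.factorial : ℚ) ≠ 0 := by exact_mod_cast n.factorial_ne_zero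
  simp only [centeredSum, mixedMomentFormula, momentFormula1, Nat.choose_zero_right, pow_one,
    pow_zero, Nat.cast_one, mul_one, one_mul, mul_zero, Finset.sum_sub_distrib, Finset.sum_const,
    Finset.card_univ, nsmul_eq_mul, card_perm_fin_cast, zero_add] at h
  rw [permExp, card_perm_fin_cast, sub_eq_zero.1 h, mul_div_cancel_left₀ _ h0]

/-- The explicit formulas hold for all `n` in their range. -/
theorem mixedMoment_eq_formula {r s n : ℕ} (hrs : r + s ≤ 8) (hn : s = 0 ∨ r + s ≤ n) :
    mixedMoment n r s = mixedMomentFormula r s (n : ℚ) := by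
  have h := centeredSum_eq hrs hn
  have h0 : (n.factorial : ℚ) ≠ 0 := by exact_mod_cast n.factorial_ne_zero
  have e : mixedMoment n r s = centeredSum r s 0 0 n / n.factorial := by
    rw [mixedMoment, permExp, card_perm_fin_cast, permExp_permInv, centeredSum]
    congr 1
    refine Finset.sum_congr rfl fun π _ => ?_
    rcases Nat.eq_zero_or_pos s with rfl | hs
    · simp
    · rw [permExp_permNa (by omega)]
      simp
  rw [e, h, mul_div_cancel_left₀ _ h0]

lemma HasLead.tendsto {d : ℕ} {c : ℚ} {f : ℚ → ℚ} (hf : HasLead d c f) :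
    Tendsto (fun n : ℕ => ((f n : ℚ) : ℝ) / (n : ℝ) ^ d) atTop (𝓝 (c : ℝ)) := by
  obtain ⟨p, hp, rfl, hpf⟩ := hf
  have h1 : ∀ n : ℕ, 0 < n → ((f n : ℚ) : ℝ) / (n : ℝ) ^ d
      = ∑ i ∈ Finset.range (d + 1), (p.coeff i : ℝ) * ((n : ℝ)⁻¹) ^ (d - i) := by
    intro n hn
    have hn0 : (n : ℝ) ≠ 0 := by positivity
    rw [hpf, Polynomial.eval_eq_sum_range' (Nat.lt_succ_of_le hp)]
    push_cast
    rw [Finset.sum_div]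
    refine Finset.sum_congr rfl fun i hi => ?_
    have hi : i ≤ d := Nat.lt_succ_iff.1 (Finset.mem_range.1 hi)
    rw [inv_pow, mul_div_assoc]
    congr 1
    rw [div_eq_iff (by positivity), eq_comm, inv_mul_eq_iff_eq_mul₀ (by positivity), ← pow_add,
      Nat.sub_add_cancel hi]
  have h2 : Tendsto (fun n : ℕ => ∑ i ∈ Finset.range (d + 1),
      (p.coeff i : ℝ) * ((n : ℝ)⁻¹) ^ (d - i)) atTop
      (𝓝 (∑ i ∈ Finset.range (d + 1), (p.coeff i : ℝ) * (0 : ℝ) ^ (d - i))) :=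
    tendsto_finsetSum _ fun i _ => (tendsto_inv_atTop_nhds_zero_nat.pow _).const_mul _
  have h3 : ∑ i ∈ Finset.range (d + 1), (p.coeff i : ℝ) * (0 : ℝ) ^ (d - i) = (p.coeff d : ℝ) := by
    rw [Finset.sum_eq_single d]
    · simp
    · intro i hi hne
      have hi : i ≤ d := Nat.lt_succ_iff.1 (Finset.mem_range.1 hi)
      rw [zero_pow (by omega), mul_zero]
    · simp
  rw [h3] at h2
  refine h2.congr' ?_
  filter_upwards [eventually_gt_atTop 0] with n hn
  exact (h1 n hn).symm

lemma normalMoment_odd {j : ℕ} (hj : Odd j) : normalMoment j = 0 := by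
  induction j using normalMoment.induct with
  | case1 => exact absurd hj (by decide)
  | case2 => rfl
  | case3 j ih =>
    rw [normalMoment, ih (by obtain ⟨m, hm⟩ := hj; exact ⟨m - 1, by omega⟩), mul_zero]

lemma mixedNormalMoment_odd {r s : ℕ} (h : Odd (r + s)) : mixedNormalMoment r s = 0 := by
  refine Finset.sum_eq_zero fun k hk => ?_
  have hk : k ≤ r + s := by have := Finset.mem_range.1 hk; omega
  rcases Nat.even_or_odd k with hk2 | hk2
  · rw [normalMoment_odd (Nat.Odd.sub_even hk h hk2)]
    ring
  · rw [normalMoment_odd hk2, mul_zero]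

/-- The moments of total order `m` are asymptotically of order at most `n ^ (3 m / 2)`. For odd `m`
the degree of the formula is below `3 m / 2`, and both sides vanish in the limit. -/
lemma tendsto_mixedMoment {r s : ℕ} (hrs : r + s ≤ 8) :
    Tendsto (fun n : ℕ => (mixedMoment n r s : ℝ) / √((n : ℝ) ^ 3) ^ (r + s)) atTop
      (𝓝 ((mixedNormalMoment r s : ℝ) / (6 ^ r * 15 ^ s))) := by
  obtain ⟨c, hc, hce⟩ := exists_hasLead_mixedMomentFormula hrs
  have h1 := hc.tendsto
  rcases Nat.even_or_odd (r + s) with he | ho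
  · obtain ⟨m, hm⟩ := he
    rw [hce ⟨m, hm⟩] at h1
    push_cast at h1
    refine h1.congr' ?_
    filter_upwards [eventually_ge_atTop (r + s)] with n hn
    rw [mixedMoment_eq_formula hrs (Or.inr hn), hm, ← two_mul, pow_mul √((n : ℝ) ^ 3),
      Real.sq_sqrt (by positivity), ← pow_mul, show 3 * (2 * m) / 2 = 3 * m by omega]
  · obtain ⟨m, hm⟩ := ho
    rw [mixedNormalMoment_odd ⟨m, hm⟩]
    have h2 : Tendsto (fun n : ℕ => √(((n : ℝ))⁻¹)) atTop (𝓝 0) := by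
      simpa [Function.comp_def] using
        (Real.continuous_sqrt.tendsto 0).comp tendsto_inv_atTop_nhds_zero_nat
    have h3 := h1.mul h2
    rw [mul_zero] at h3
    rw [Rat.cast_zero, zero_div]
    refine h3.congr' ?_
    filter_upwards [eventually_ge_atTop (r + s)] with n hn
    have hn0 : (0 : ℝ) < n := by exact_mod_cast (by omega : 0 < n)
    have h4 : √((n : ℝ) ^ 3) ^ (2 * m + 1) = (n : ℝ) ^ (3 * m + 1) * √(n : ℝ) := by
      rw [pow_succ, pow_mul, Real.sq_sqrt (by positivity), ← pow_mul,
        show (n : ℝ) ^ 3 = n ^ 2 * n by ring, Real.sqrt_mul (by positivity),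
        Real.sqrt_sq hn0.le]
      ring
    rw [mixedMoment_eq_formula hrs (Or.inr hn), hm, h4, Real.sqrt_inv,
      show 3 * (2 * m + 1) / 2 = 3 * m + 1 by omega, ← div_div, div_eq_mul_inv _ √(n : ℝ)]

/-- The standard deviations are asymptotic to `n ^ (3 / 2) / 6` and `√10 * n ^ (3 / 2) / 15`. -/
lemma tendsto_scaledMixedMoment {r s : ℕ} (hrs : r + s ≤ 8) :
    Tendsto (fun n : ℕ => scaledMixedMoment n r s) atTop
      (𝓝 ((mixedNormalMoment r s : ℝ) / √10 ^ s)) := by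
  have hsqrt : ∀ r s : ℕ, r + s = 2 → Tendsto (fun n : ℕ => √(mixedMoment n r s : ℝ)
      / √((n : ℝ) ^ 3)) atTop (𝓝 √((mixedNormalMoment r s : ℝ) / (6 ^ r * 15 ^ s))) := by
    intro r s h
    refine ((Real.continuous_sqrt.tendsto _).comp (tendsto_mixedMoment (r := r) (s := s)
      (by omega))).congr fun n => ?_
    simp only [Function.comp_apply]
    rw [h, Real.sq_sqrt (by positivity), Real.sqrt_div' _ (by positivity)]
  have h20 := hsqrt 2 0 rfl
  have h02 := hsqrt 0 2 rfl
  have e20 : √((mixedNormalMoment 2 0 : ℝ) / (6 ^ 2 * 15 ^ 0)) = 1 / 6 := by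
    rw [show mixedNormalMoment 2 0 = 1 by decide +kernel,
      Real.sqrt_eq_iff_eq_sq (by norm_num) (by norm_num)]
    norm_num
  have e02 : √((mixedNormalMoment 0 2 : ℝ) / (6 ^ 0 * 15 ^ 2)) = √10 / 15 := by
    rw [show mixedNormalMoment 0 2 = 10 by decide +kernel, Real.sqrt_div' _ (by norm_num),
      show (6 ^ 0 * 15 ^ 2 : ℝ) = 15 ^ 2 by norm_num, Real.sqrt_sq (by norm_num)]
    norm_num
  rw [e20] at h20
  rw [e02] at h02
  have h := (tendsto_mixedMoment hrs).div ((h20.pow r).mul (h02.pow s)) (by positivity)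
  have hlim : (mixedNormalMoment r s : ℝ) / (6 ^ r * 15 ^ s) / ((1 / 6) ^ r * (√10 / 15) ^ s)
      = (mixedNormalMoment r s : ℝ) / √10 ^ s := by
    have : (0 : ℝ) < √10 := by positivity
    rw [div_pow, div_pow, one_pow]
    field_simp
  rw [hlim] at h
  refine h.congr' ?_
  filter_upwards [eventually_gt_atTop 0] with n hn
  have hn0 : (0 : ℝ) < √((n : ℝ) ^ 3) := by positivity
  simp only [Pi.div_apply]
  rw [scaledMixedMoment, div_pow, div_pow, div_mul_div_comm, ← pow_add,
    div_div_div_cancel_right₀ (by positivity)]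

/-! ### Moments of the bivariate normal distribution -/

/-- The unnormalized weight `exp (-x ^ 2 / 2)`. -/
noncomputable def normalWeight (x : ℝ) : ℝ := Real.exp (-(1 / 2) * x ^ 2)

lemma integrable_pow_mul_normalWeight (j : ℕ) :
    Integrable fun x : ℝ => x ^ j * normalWeight x := by
  simpa [normalWeight] using integrable_rpow_mul_exp_neg_mul_sq (b := 1 / 2) (by norm_num)
    (s := (j : ℝ)) (by linarith [(Nat.cast_nonneg j : (0 : ℝ) ≤ j)])

/-- Integration by parts, with `-normalWeight` as the antiderivative of `x * normalWeight x`. -/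
lemma integral_pow_succ_mul_normalWeight (j : ℕ) :
    ∫ x : ℝ, x ^ (j + 1) * normalWeight x = j * ∫ x : ℝ, x ^ (j - 1) * normalWeight x := by
  have hv : ∀ x : ℝ, HasDerivAt (fun x => -normalWeight x) (x * normalWeight x) x := by
    intro x
    have h : HasDerivAt (fun x : ℝ => -(1 / 2) * x ^ 2) (-x) x :=
      ((hasDerivAt_pow 2 x).const_mul (-(1 / 2) : ℝ)).congr_deriv (by push_cast; ring)
    exact h.exp.neg.congr_deriv (by simp only [normalWeight]; ring)
  have hu : ∀ x : ℝ, HasDerivAt (fun x : ℝ => x ^ j) (j * x ^ (j - 1)) x := hasDerivAt_pow j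
  have e1 : ((fun x : ℝ => x ^ j) * fun x => x * normalWeight x)
      = fun x => x ^ (j + 1) * normalWeight x := by
    ext x; simp only [Pi.mul_apply]; ring
  have e2 : ((fun x : ℝ => (j : ℝ) * x ^ (j - 1)) * fun x => -normalWeight x)
      = fun x => (-(j : ℝ)) * (x ^ (j - 1) * normalWeight x) := by
    ext x; simp only [Pi.mul_apply]; ring
  have e3 : ((fun x : ℝ => x ^ j) * fun x => -normalWeight x)
      = fun x => -(x ^ j * normalWeight x) := by
    ext x; simp only [Pi.mul_apply]; ring
  have key := integral_mul_deriv_eq_deriv_mul_of_integrable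
    (u := fun x : ℝ => x ^ j) (v := fun x => -normalWeight x)
    (u' := fun x : ℝ => j * x ^ (j - 1)) (v' := fun x => x * normalWeight x)
    (fun x _ => hu x) (fun x _ => hv x)
    (by rw [e1]; exact integrable_pow_mul_normalWeight _)
    (by rw [e2]; exact (integrable_pow_mul_normalWeight _).const_mul _)
    (by rw [e3]; exact (integrable_pow_mul_normalWeight _).neg)
  have f1 : ∫ x : ℝ, x ^ (j + 1) * normalWeight x = ∫ x : ℝ, x ^ j * (x * normalWeight x) :=
    integral_congr_ae (ae_of_all _ fun x => by simp only; ring)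
  rw [f1, key, ← integral_neg, ← integral_const_mul]
  exact integral_congr_ae (ae_of_all _ fun x => by simp only; ring)

lemma integral_pow_mul_normalWeight (j : ℕ) :
    ∫ x : ℝ, x ^ j * normalWeight x = normalMoment j * √(2 * Real.pi) := by
  induction j using normalMoment.induct with
  | case1 =>
    have h := integral_gaussian (1 / 2)
    simp only [pow_zero, one_mul, normalWeight, normalMoment, h]
    rw [Rat.cast_one, one_mul]
    congr 1
    ring
  | case2 => simpa [normalMoment] using integral_pow_succ_mul_normalWeight 0
  | case3 j ih =>
    have h := integral_pow_succ_mul_normalWeight (j + 1)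
    rw [Nat.add_sub_cancel, ih] at h
    rw [h, normalMoment]
    push_cast
    ring

/-- Binomial expansion in independent standard normal variables. -/
lemma integral_pow_mul_add_pow (r s : ℕ) :
    Integrable (fun p : ℝ × ℝ => p.1 ^ r * (3 * p.1 + p.2) ^ s
      * (normalWeight p.1 * normalWeight p.2)) ∧
    ∫ p : ℝ × ℝ, p.1 ^ r * (3 * p.1 + p.2) ^ s * (normalWeight p.1 * normalWeight p.2)
      = 2 * Real.pi * mixedNormalMoment r s := by
  have e : (fun p : ℝ × ℝ => p.1 ^ r * (3 * p.1 + p.2) ^ s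
      * (normalWeight p.1 * normalWeight p.2))
      = fun p : ℝ × ℝ => ∑ k ∈ Finset.range (s + 1), ((s.choose k : ℝ) * 3 ^ (s - k)) *
        ((p.1 ^ (r + s - k) * normalWeight p.1) * (p.2 ^ k * normalWeight p.2)) := by
    ext p
    rw [add_comm (3 * p.1), add_pow, Finset.mul_sum, Finset.sum_mul]
    refine Finset.sum_congr rfl fun k hk => ?_
    have hk : k ≤ s := Nat.lt_succ_iff.1 (Finset.mem_range.1 hk)
    rw [mul_pow, Nat.add_sub_assoc hk, pow_add]
    ring
  have hint : ∀ k, Integrable (fun p : ℝ × ℝ => ((s.choose k : ℝ) * 3 ^ (s - k)) *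
        ((p.1 ^ (r + s - k) * normalWeight p.1) * (p.2 ^ k * normalWeight p.2))) := fun k =>
    ((integrable_pow_mul_normalWeight _).mul_prod (integrable_pow_mul_normalWeight _)).const_mul _
  rw [e]
  refine ⟨integrable_finsetSum _ fun k _ => hint k, ?_⟩
  rw [integral_finsetSum _ fun k _ => hint k, mixedNormalMoment]
  push_cast
  rw [Finset.mul_sum]
  refine Finset.sum_congr rfl fun k _ => ?_
  have hprod := integral_prod_mul (μ := (volume : Measure ℝ)) (ν := (volume : Measure ℝ))
    (fun x : ℝ => x ^ (r + s - k) * normalWeight x) (fun x : ℝ => x ^ k * normalWeight x)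
  rw [integral_const_mul, Measure.volume_eq_prod, hprod, integral_pow_mul_normalWeight,
    integral_pow_mul_normalWeight]
  have h2 : √(2 * Real.pi) * √(2 * Real.pi) = 2 * Real.pi :=
    Real.mul_self_sqrt (by positivity)
  linear_combination ((s.choose k : ℝ) * 3 ^ (s - k) * normalMoment (r + s - k)
    * normalMoment k) * h2

/-- The substitution `x = σ₁ u`, `y = σ₂ (3 u + v) / √10` turns the bivariate normal density with
correlation `3 / √10` into the standard one. -/
lemma integral_bivariateNormalPDF (r s : ℕ) {σ₁ σ₂ : ℝ} (h₁ : 0 < σ₁) (h₂ : 0 < σ₂) :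
    Integrable (fun p : ℝ × ℝ =>
      p.1 ^ r * p.2 ^ s * bivariateNormalPDF σ₁ σ₂ (3 / √10) p.1 p.2) ∧
    ∫ p : ℝ × ℝ, p.1 ^ r * p.2 ^ s * bivariateNormalPDF σ₁ σ₂ (3 / √10) p.1 p.2
      = σ₁ ^ r * σ₂ ^ s * (mixedNormalMoment r s / √10 ^ s) := by
  have ht : (0 : ℝ) < √10 := by positivity
  have ht2 : √10 ^ 2 = (10 : ℝ) := Real.sq_sqrt (by norm_num)
  set t : ℝ := √10
  set F : ℝ × ℝ → ℝ := fun p => p.1 ^ r * p.2 ^ s * bivariateNormalPDF σ₁ σ₂ (3 / t) p.1 p.2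
    with hF
  let A : Matrix (Fin 2) (Fin 2) ℝ := !![σ₁, 0; 3 * σ₂ / t, σ₂ / t]
  let L : ℝ × ℝ →ₗ[ℝ] ℝ × ℝ :=
    Matrix.toLin (Module.Basis.finTwoProd ℝ) (Module.Basis.finTwoProd ℝ) A
  have hL : ∀ p : ℝ × ℝ, L p = (σ₁ * p.1, σ₂ / t * (3 * p.1 + p.2)) := by
    intro p
    simp only [L, A, Matrix.toLin_finTwoProd_apply]
    ext
    · simp
    · simp only; ring
  have hdet : LinearMap.det L = σ₁ * σ₂ / t := by
    simp only [L, LinearMap.det_toLin, A, Matrix.det_fin_two_of]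
    ring
  have hdet0 : LinearMap.det L ≠ 0 := by rw [hdet]; positivity
  have hmap := Measure.map_linearMap_addHaar_eq_smul_addHaar (volume : Measure (ℝ × ℝ)) hdet0
  have habs : |(LinearMap.det L)⁻¹| = t / (σ₁ * σ₂) := by
    rw [hdet, abs_of_pos (by positivity), inv_div]
  rw [habs] at hmap
  have hFc : Continuous F := by
    simp only [hF, bivariateNormalPDF]
    fun_prop
  have hLm : AEMeasurable (L : ℝ × ℝ → ℝ × ℝ) volume :=
    (LinearMap.continuous_of_finiteDimensional L).aemeasurable
  have hrho : 1 - (3 / t) ^ 2 = 1 / 10 := by rw [div_pow, ht2]; norm_num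
  have hsq : √(1 / 10 : ℝ) = 1 / t := by
    rw [Real.sqrt_div' _ (by norm_num), Real.sqrt_one]
  have hcomp : F ∘ L = fun p : ℝ × ℝ =>
      (σ₁ ^ r * σ₂ ^ s / t ^ s * (t / (2 * Real.pi * σ₁ * σ₂))) *
      (p.1 ^ r * (3 * p.1 + p.2) ^ s * (normalWeight p.1 * normalWeight p.2)) := by
    ext p
    simp only [Function.comp_apply, hF, hL, bivariateNormalPDF, hrho, hsq, normalWeight]
    rw [← Real.exp_add]
    have hexp : -(1 / (2 * (1 / 10))) * ((σ₁ * p.1) ^ 2 / σ₁ ^ 2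
        - 2 * (3 / t) * (σ₁ * p.1) * (σ₂ / t * (3 * p.1 + p.2)) / (σ₁ * σ₂)
        + (σ₂ / t * (3 * p.1 + p.2)) ^ 2 / σ₂ ^ 2)
        = -(1 / 2) * p.1 ^ 2 + -(1 / 2) * p.2 ^ 2 := by
      field_simp
      rw [ht2]
      ring
    rw [hexp, mul_pow, mul_pow, div_pow]
    field_simp
  obtain ⟨hi, hv⟩ := integral_pow_mul_add_pow r s
  have hc0 : ENNReal.ofReal (t / (σ₁ * σ₂)) ≠ 0 := by
    rw [Ne, ENNReal.ofReal_eq_zero, not_le]; positivity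
  have hint : Integrable (F ∘ L) := by rw [hcomp]; exact hi.const_mul _
  have hintF : Integrable F := by
    have h := (integrable_map_measure (hFc.aestronglyMeasurable) hLm).2 hint
    rw [hmap] at h
    exact (integrable_smul_measure hc0 ENNReal.ofReal_ne_top).1 h
  refine ⟨hintF, ?_⟩
  have h1 : ∫ p, F p ∂(Measure.map L volume) = ∫ p, F (L p) :=
    integral_map hLm hFc.aestronglyMeasurable
  have h2 : ∫ p, F (L p) = ∫ p, (F ∘ L) p := rfl
  rw [h2, hcomp, integral_const_mul, hv, hmap, integral_smul_measure,
    ENNReal.toReal_ofReal (by positivity), smul_eq_mul] at h1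
  have h3 : (0 : ℝ) < t / (σ₁ * σ₂) := by positivity
  refine mul_left_cancel₀ h3.ne' (h1.trans ?_)
  field_simp

theorem mainTheorem4 :
    (∀ r s : ℕ, r + s ≤ 8 → ∀ n : ℕ, (s = 0 ∨ r + s ≤ n) →
      mixedMoment n r s = mixedMomentFormula r s (n : ℚ)) ∧
    Tendsto (fun n : ℕ => scaledMixedMoment n 1 1) atTop (𝓝 (3 / √10)) ∧
    (∀ r s : ℕ, r + s ≤ 8 → ∀ σ₁ σ₂ : ℝ, 0 < σ₁ → 0 < σ₂ →
      Integrable (fun p : ℝ × ℝ =>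
        p.1 ^ r * p.2 ^ s * bivariateNormalPDF σ₁ σ₂ (3 / √10) p.1 p.2) ∧
      Tendsto (fun n : ℕ => scaledMixedMoment n r s) atTop
        (𝓝 ((∫ p : ℝ × ℝ,
          p.1 ^ r * p.2 ^ s * bivariateNormalPDF σ₁ σ₂ (3 / √10) p.1 p.2) /
            (σ₁ ^ r * σ₂ ^ s)))) := by
  refine ⟨fun r s hrs n hn => mixedMoment_eq_formula hrs hn, ?_, fun r s hrs σ₁ σ₂ h₁ h₂ => ?_⟩
  · have h := tendsto_scaledMixedMoment (r := 1) (s := 1) (by norm_num)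
    rw [show mixedNormalMoment 1 1 = 3 by decide +kernel] at h
    simpa using h
  · obtain ⟨hi, hv⟩ := integral_bivariateNormalPDF r s h₁ h₂
    refine ⟨hi, ?_⟩
    rw [hv, mul_div_cancel_left₀ _ (by positivity)]
    exact tendsto_scaledMixedMoment hrs
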